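/- Let $\Omega=\mathbb{R}\times[0,1]$, $\Omega_0=(-1/2,1/2]\times[0,1]$, let $k>0$ and let $q:\Omega\to\mathbb{R}$ be measurable, bounded, bounded below by a positive constant, and $1$-periodic in $x_1$. For $z\in\mathbb{C}\setminus\{0\}$ let $H^1_z(\Omega_0)$ be the space of all $\phi\in H^1(\Omega_0)$ whose extension $(E_z\phi)(x_1+n,x_2)=z^n\phi(x_1,x_2)$, $x\in\Omega_0$, $n\in\mathbb{Z}$, lies in $H^1_{loc}(\Omega)$, and put $H^1_{per}(\Omega_0)=H^1_1(\Omega_0)$. For $f\in L^2(\Omega_0)$ a function $w\in H^1_z(\Omega_0)$ is called a (weak) solution of $$\Delta w+k^2qw=f\ \text{ in }\Omega_0,\qquad \frac{\partial w}{\partial x_2}=0\ \text{ for } x_2\in\{0,1\},\tag{1}$$ if $\int_{\Omega_0}\left[\nabla w\cdot\nabla\chi-k^2q\,w\chi\right]dx=-\int_{\Omega_0}f\chi\,dx$ for all $\chi\in H^1_{z^{-1}}(\Omega_0)$. Let $\mathbb{F}$ be the set of all $z\in\mathbb{C}\setminus\{0\}$ for which (1) with $f=0$ has a nontrivial solution in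 $H^1_z(\Omega_0)$. For every $z\in\mathbb{C}\setminus(\mathbb{F}\cup\{0\})$ and every $f\in L^2(\Omega_0)$, problem (1) has exactly one solution $w(z,\cdot)\in H^1_z(\Omega_0)$. Let $a:[-1,1]\to\mathbb{C}\setminus(\mathbb{F}\cup\{0\})$ be real-analytic (on the closed interval) and injective, with $a'(t)\neq0$ for all $t\in[-1,1]$. There is a continuous $\lambda:[-1,1]\to\mathbb{C}$ with $e^{\lambda(t)}=a(t)$ for all $t$ (a branch of $\log a(t)$), and for each such $\lambda$ the following holds for $$v_{a(t)}(x):=e^{-x_1\lambda(t)}\,w(a(t),x)\qquad (\,=a(t)^{-x_1}w(a(t),x)\,).$$ 1. For every $f\in L^2(\Omega_0)$, $v_{a(t)}$ belongs to $H^1_{per}(\Omega_0)$, and $t\mapsto v_{a(t)}\in H^1_{per}(\Omega_0)$ is real-analytic on $[-1,1]$. 2. For every integer $m\ge0$ there is a constant $C$, independent of $f$ and $t$, such that $\left\|\partial_t^m v_{a(t)}\right\|_{H^1(\Omega_0)}\le C\|f\|_{L^2(\Omega_0)}$ for all $t\in[-1,1]$ and all $f\in L^2(\Omega_0)$; in particular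 this holds for $m=1$. 3. The same is true for $w(a(t),\cdot)$: it depends real-analytically on $t\in[-1,1]$ as an element of $H^1(\Omega_0)$, and for every $m\ge0$ there is a constant $C$, independent of $f$ and $t$, with $\left\|\partial_t^m w(a(t),\cdot)\right\|_{H^1(\Omega_0)}\le C\|f\|_{L^2(\Omega_0)}$ for all $t\in[-1,1]$. -/

import Mathlib

open MeasureTheory Set Filter Topology
open scoped ContDiff

noncomputable section

namespace PeriodicWaveguide

/-- The waveguide `Ω = ℝ × [0,1]`. -/
def waveguide : Set (ℝ × ℝ) := univ ×ˢ Icc 0 1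

/-- The interior `ℝ × (0,1)` of the waveguide. -/
def guideInterior : Set (ℝ × ℝ) := univ ×ˢ Ioo 0 1

/-- The periodicity cell `Ω₀ = (-1/2, 1/2] × [0,1]`. -/
def cell : Set (ℝ × ℝ) := Ioc (-1 / 2) (1 / 2) ×ˢ Icc 0 1

/-- The interior `(-1/2, 1/2) × (0,1)` of the cell. -/
def cellInterior : Set (ℝ × ℝ) := Ioo (-1 / 2) (1 / 2) ×ˢ Ioo 0 1

/-- `L²(Ω₀)`, complex valued. -/
abbrev L2Cell : Type := Lp ℂ 2 (volume.restrict cell)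

/-- On the open set `O`, the function `h` is the weak (distributional) derivative of `g` in the
direction `e`; both are locally integrable on `O`. -/
def HasWeakPartial (O : Set (ℝ × ℝ)) (e : ℝ × ℝ) (g h : ℝ × ℝ → ℂ) : Prop :=
  LocallyIntegrableOn g O ∧ LocallyIntegrableOn h O ∧
    ∀ ψ : ℝ × ℝ → ℝ, ContDiff ℝ ∞ ψ → HasCompactSupport ψ → tsupport ψ ⊆ O →
      ∫ x in O, (fderiv ℝ ψ x e) • g x = -∫ x in O, ψ x • h x

/-- The `z`-quasi-periodic extension: `(E_z g)(x₁ + n, x₂) = z ^ n * g (x₁, x₂)` for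
`(x₁, x₂) ∈ Ω₀` and `n ∈ ℤ`. The integer `⌈x₁ - 1/2⌉` is the only `n` with
`x₁ - n ∈ (-1/2, 1/2]`. -/
def qpExt (z : ℂ) (g : ℝ × ℝ → ℂ) (x : ℝ × ℝ) : ℂ :=
  z ^ ⌈x.1 - 1 / 2⌉ * g (x.1 - ⌈x.1 - 1 / 2⌉, x.2)

/-- Triples of `L²(Ω₀)` functions, with the norm `(‖u₀‖² + ‖u₁‖² + ‖u₂‖²) ^ (1/2)`. -/
abbrev L2Triple : Type := PiLp 2 (fun _ : Fin 3 => L2Cell)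

theorem qpExt_spec (z : ℂ) (g : ℝ × ℝ → ℂ) (x : ℝ × ℝ) (hx : x ∈ cell) (n : ℤ) :
    qpExt z g (x.1 + n, x.2) = z ^ n * g x := by
  have h1 : ⌈x.1 + n - 1 / 2⌉ = n := by
    rw [Int.ceil_eq_iff]
    have := hx.1.1
    have := hx.1.2
    constructor <;> linarith
  simp only [qpExt, h1]
  simp

theorem foldBack_mem {x : ℝ × ℝ} (hx : x ∈ guideInterior) :
    ((x.1 - ⌈x.1 - 1 / 2⌉, x.2) : ℝ × ℝ) ∈ cell := by
  have h1 := Int.ceil_lt_add_one (x.1 - 1 / 2)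
  have h2 := Int.le_ceil (x.1 - 1 / 2)
  refine ⟨⟨?_, ?_⟩, hx.2.1.le, hx.2.2.le⟩
  · dsimp only
    linarith
  · dsimp only
    linarith

theorem qpExt_congr (z : ℂ) {g g' : ℝ × ℝ → ℂ} (h : g =ᵐ[volume.restrict cell] g') :
    qpExt z g =ᵐ[volume.restrict guideInterior] qpExt z g' := by
  have hc : MeasurableSet cell := measurableSet_Ioc.prod measurableSet_Icc
  have hs : MeasurableSet guideInterior := MeasurableSet.univ.prod measurableSet_Ioo
  have h1 : ∀ᵐ x : ℝ × ℝ, x ∈ cell → g x = g' x := (ae_restrict_iff' hc).1 h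
  have h2 : ∀ n : ℤ, ∀ᵐ x : ℝ × ℝ,
      (x - ((n : ℝ), (0 : ℝ))) ∈ cell →
        g (x - ((n : ℝ), (0 : ℝ))) = g' (x - ((n : ℝ), (0 : ℝ))) := fun n =>
    (measurePreserving_sub_right volume ((n : ℝ), (0 : ℝ))).quasiMeasurePreserving.ae h1
  refine (ae_restrict_iff' hs).2 ?_
  filter_upwards [ae_all_iff.2 h2] with x hx hxs
  have h3 := hx ⌈x.1 - 1 / 2⌉
  have h4 : x - ((⌈x.1 - 1 / 2⌉ : ℝ), (0 : ℝ)) = (x.1 - ⌈x.1 - 1 / 2⌉, x.2) := by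
    ext <;> simp
  rw [h4] at h3
  simp only [qpExt, h3 (foldBack_mem hxs)]

theorem HasWeakPartial.congr {O : Set (ℝ × ℝ)} {e : ℝ × ℝ} {g g' h h' : ℝ × ℝ → ℂ}
    (H : HasWeakPartial O e g h) (hg : g =ᵐ[volume.restrict O] g')
    (hh : h =ᵐ[volume.restrict O] h') : HasWeakPartial O e g' h' := by
  refine ⟨?_, ?_, fun ψ h1 h2 h3 => ?_⟩
  · intro x hx
    obtain ⟨s, hs, hi⟩ := H.1 x hx
    refine ⟨s ∩ O, inter_mem hs self_mem_nhdsWithin, ?_⟩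
    exact (hi.mono_set inter_subset_left).congr_fun_ae
      (ae_restrict_of_ae_restrict_of_subset inter_subset_right hg)
  · intro x hx
    obtain ⟨s, hs, hi⟩ := H.2.1 x hx
    refine ⟨s ∩ O, inter_mem hs self_mem_nhdsWithin, ?_⟩
    exact (hi.mono_set inter_subset_left).congr_fun_ae
      (ae_restrict_of_ae_restrict_of_subset inter_subset_right hh)
  · have e1 : ∫ x in O, (fderiv ℝ ψ x e) • g' x = ∫ x in O, (fderiv ℝ ψ x e) • g x :=
      integral_congr_ae (by filter_upwards [hg] with x hx; rw [hx])
    have e2 : ∫ x in O, ψ x • h' x = ∫ x in O, ψ x • h x :=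
      integral_congr_ae (by filter_upwards [hh] with x hx; rw [hx])
    rw [e1, e2]
    exact H.2.2 ψ h1 h2 h3

theorem HasWeakPartial.zero (O : Set (ℝ × ℝ)) (e : ℝ × ℝ) :
    HasWeakPartial O e (fun _ => 0) (fun _ => 0) :=
  ⟨(locallyIntegrable_zero).locallyIntegrableOn O, (locallyIntegrable_zero).locallyIntegrableOn O,
    fun _ _ _ _ => by simp⟩

theorem integrableOn_smul_test {O : Set (ℝ × ℝ)} {g : ℝ × ℝ → ℂ}
    (hg : LocallyIntegrableOn g O) {φ : ℝ × ℝ → ℝ} (hφ : Continuous φ)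
    (hc : HasCompactSupport φ) (hs : tsupport φ ⊆ O) :
    IntegrableOn (fun x => φ x • g x) O := by
  have h1 : IntegrableOn g (tsupport φ) := hg.integrableOn_compact_subset hs hc
  have h2 : IntegrableOn (fun x => φ x • g x) (tsupport φ) :=
    h1.continuousOn_smul hφ.continuousOn hc
  have h3 : Integrable (fun x => φ x • g x) := by
    rw [← integrableOn_iff_integrable_of_support_subset (s := tsupport φ)]
    · exact h2
    · intro x hx
      refine subset_tsupport φ ?_
      intro h0
      exact hx (by simp [h0])
  exact h3.integrableOn

theorem HasWeakPartial.add {O : Set (ℝ × ℝ)} {e : ℝ × ℝ}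
    {g h g' h' : ℝ × ℝ → ℂ} (H : HasWeakPartial O e g h) (H' : HasWeakPartial O e g' h') :
    HasWeakPartial O e (fun x => g x + g' x) (fun x => h x + h' x) := by
  refine ⟨H.1.add H'.1, H.2.1.add H'.2.1, fun ψ h1 h2 h3 => ?_⟩
  have hd : Continuous (fun x => fderiv ℝ ψ x e) :=
    (h1.continuous_fderiv (by simp)).clm_apply continuous_const
  have hdc : HasCompactSupport (fun x => fderiv ℝ ψ x e) := h2.fderiv_apply ℝ e
  have hds : tsupport (fun x => fderiv ℝ ψ x e) ⊆ O :=
    (tsupport_fderiv_apply_subset ℝ e).trans h3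
  simp only [smul_add]
  rw [integral_add (integrableOn_smul_test H.1 hd hdc hds)
      (integrableOn_smul_test H'.1 hd hdc hds),
    integral_add (integrableOn_smul_test H.2.1 h1.continuous h2 h3)
      (integrableOn_smul_test H'.2.1 h1.continuous h2 h3),
    H.2.2 ψ h1 h2 h3, H'.2.2 ψ h1 h2 h3, neg_add]

theorem HasWeakPartial.const_mul {O : Set (ℝ × ℝ)} {e : ℝ × ℝ} {g h : ℝ × ℝ → ℂ} (c : ℂ)
    (H : HasWeakPartial O e g h) : HasWeakPartial O e (fun x => c * g x) (fun x => c * h x) := by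
  refine ⟨H.1.smul c, H.2.1.smul c, fun ψ h1 h2 h3 => ?_⟩
  have e1 : ∀ (r : ℝ) (y : ℂ), r • (c * y) = c * (r • y) := fun r y => by
    rw [Complex.real_smul, Complex.real_smul]; ring
  simp only [e1, integral_const_mul]
  rw [H.2.2 ψ h1 h2 h3, mul_neg]

theorem cellInterior_subset_cell : cellInterior ⊆ cell :=
  prod_mono Ioo_subset_Ioc_self Ioo_subset_Icc_self

/-- The Sobolev space `H¹(Ω₀)`: a function `u` is represented by the triple
`(u, ∂₁u, ∂₂u)` of itself and its weak derivatives, all in `L²(Ω₀)`. The norm is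
`(‖u‖² + ‖∂₁u‖² + ‖∂₂u‖²) ^ (1/2)`. -/
def H1Cell : Submodule ℂ L2Triple where
  carrier := {u | HasWeakPartial cellInterior (1, 0) (u 0) (u 1) ∧
    HasWeakPartial cellInterior (0, 1) (u 0) (u 2)}
  zero_mem' := by
    have h0 : ∀ i : Fin 3, (fun _ => (0 : ℂ)) =ᵐ[volume.restrict cellInterior]
        (((0 : L2Triple) i : L2Cell) : ℝ × ℝ → ℂ) := fun i =>
      ae_restrict_of_ae_restrict_of_subset cellInterior_subset_cell
        (Lp.coeFn_zero ℂ 2 (volume.restrict cell)).symm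
    exact ⟨(HasWeakPartial.zero _ _).congr (h0 0) (h0 1),
      (HasWeakPartial.zero _ _).congr (h0 0) (h0 2)⟩
  add_mem' := by
    intro u v hu hv
    have h0 : ∀ i : Fin 3, (fun x => (u i : ℝ × ℝ → ℂ) x + (v i : ℝ × ℝ → ℂ) x)
        =ᵐ[volume.restrict cellInterior] (((u + v) i : L2Cell) : ℝ × ℝ → ℂ) := fun i =>
      ae_restrict_of_ae_restrict_of_subset cellInterior_subset_cell
        (Lp.coeFn_add (u i) (v i)).symm
    exact ⟨(hu.1.add hv.1).congr (h0 0) (h0 1),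
      (hu.2.add hv.2).congr (h0 0) (h0 2)⟩
  smul_mem' := by
    intro c u hu
    have h0 : ∀ i : Fin 3, (fun x => c * (u i : ℝ × ℝ → ℂ) x)
        =ᵐ[volume.restrict cellInterior] (((c • u) i : L2Cell) : ℝ × ℝ → ℂ) := fun i =>
      ae_restrict_of_ae_restrict_of_subset cellInterior_subset_cell
        (Lp.coeFn_smul c (u i)).symm
    exact ⟨(hu.1.const_mul c).congr (h0 0) (h0 1), (hu.2.const_mul c).congr (h0 0) (h0 2)⟩

/-- The function `u` itself, for `u ∈ H¹(Ω₀)`. -/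
abbrev fn (u : H1Cell) : ℝ × ℝ → ℂ := ((u : L2Triple) 0 : L2Cell)

/-- The weak derivative `∂₁u`, for `u ∈ H¹(Ω₀)`. -/
abbrev d1 (u : H1Cell) : ℝ × ℝ → ℂ := ((u : L2Triple) 1 : L2Cell)

/-- The weak derivative `∂₂u`, for `u ∈ H¹(Ω₀)`. -/
abbrev d2 (u : H1Cell) : ℝ × ℝ → ℂ := ((u : L2Triple) 2 : L2Cell)

/-- The space `H¹_z(Ω₀)` of the `u ∈ H¹(Ω₀)` whose extension `E_z u` lies in `H¹_loc(Ω)`.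
The weak gradient is local, so the one of `E_z u` can only be `E_z (∇u)`, and this one is square
integrable on bounded subsets of `Ω`. -/
def H1qp (z : ℂ) : Submodule ℂ H1Cell where
  carrier := {u | HasWeakPartial guideInterior (1, 0) (qpExt z (fn u)) (qpExt z (d1 u)) ∧
    HasWeakPartial guideInterior (0, 1) (qpExt z (fn u)) (qpExt z (d2 u))}
  zero_mem' := by
    have h0 : ∀ i : Fin 3, (fun _ => (0 : ℂ)) =ᵐ[volume.restrict guideInterior]
        qpExt z ((((0 : H1Cell) : L2Triple) i : L2Cell) : ℝ × ℝ → ℂ) := fun i => by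
      have h := qpExt_congr z (Lp.coeFn_zero ℂ 2 (volume.restrict cell)).symm
      refine EventuallyEq.trans (Eventually.of_forall fun x => ?_) h
      simp [qpExt]
    exact ⟨(HasWeakPartial.zero _ _).congr (h0 0) (h0 1),
      (HasWeakPartial.zero _ _).congr (h0 0) (h0 2)⟩
  add_mem' := by
    intro u v hu hv
    have h0 : ∀ i : Fin 3, (fun x => qpExt z ((u : L2Triple) i : L2Cell) x +
          qpExt z ((v : L2Triple) i : L2Cell) x) =ᵐ[volume.restrict guideInterior]
        qpExt z ((((u + v : H1Cell) : L2Triple) i : L2Cell) : ℝ × ℝ → ℂ) := fun i => by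
      have h := qpExt_congr z
        (Lp.coeFn_add ((u : L2Triple) i : L2Cell) ((v : L2Triple) i : L2Cell)).symm
      refine EventuallyEq.trans (Eventually.of_forall fun x => ?_) h
      simp [qpExt, mul_add]
    exact ⟨(hu.1.add hv.1).congr (h0 0) (h0 1),
      (hu.2.add hv.2).congr (h0 0) (h0 2)⟩
  smul_mem' := by
    intro c u hu
    have h0 : ∀ i : Fin 3, (fun x => c * qpExt z ((u : L2Triple) i : L2Cell) x)
        =ᵐ[volume.restrict guideInterior]
        qpExt z ((((c • u : H1Cell) : L2Triple) i : L2Cell) : ℝ × ℝ → ℂ) := fun i => by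
      have h := qpExt_congr z (Lp.coeFn_smul c ((u : L2Triple) i : L2Cell)).symm
      refine EventuallyEq.trans (Eventually.of_forall fun x => ?_) h
      simp [qpExt, mul_left_comm]
    exact ⟨(hu.1.const_mul c).congr (h0 0) (h0 1), (hu.2.const_mul c).congr (h0 0) (h0 2)⟩

/-- The space `H¹_per(Ω₀)`, i.e. quasi-periodicity `z = 1`. -/
abbrev H1per : Submodule ℂ H1Cell := H1qp 1

/-- `w ∈ H¹_z(Ω₀)` is a weak solution of `Δw + k² q w = f` in `Ω₀` with `∂w/∂x₂ = 0` on the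
walls `x₂ = 0, 1`. The test functions are `z⁻¹`-quasi-periodic, so that the contributions of
`x₁ = ±1/2` cancel in Green's formula. -/
def IsQPSolution (k : ℝ) (q : ℝ × ℝ → ℝ) (z : ℂ) (f : L2Cell) (w : H1Cell) : Prop :=
  w ∈ H1qp z ∧ ∀ χ ∈ H1qp z⁻¹,
    ∫ x in cell, (d1 w x * d1 χ x + d2 w x * d2 χ x - (k : ℂ) ^ 2 * (q x : ℂ) * fn w x * fn χ x)
      = -∫ x in cell, f x * fn χ x

/-- The set `𝔽` of Floquet multipliers: the `z ≠ 0` for which the homogeneous problem has a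
nontrivial solution in `H¹_z(Ω₀)`. -/
def floquetMultipliers (k : ℝ) (q : ℝ × ℝ → ℝ) : Set ℂ :=
  {z | z ≠ 0 ∧ ∃ w : H1Cell, w ≠ 0 ∧ IsQPSolution k q z 0 w}

end PeriodicWaveguide

end

noncomputable section

namespace PeriodicWaveguide

/-! The obstacle is that the space `H1qp (a t)` moves with `t`. The gauge `w = exp (l x₁) v` with
`exp l = z` removes it: `v` lies in the fixed Hilbert space `H¹_per(Ω₀)`, and test functions `χ =
exp (-l x₁) * conj φ` with `φ` periodic exhaust `H1qp z⁻¹`. The exponentials cancel in the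
integrand, and (1) becomes `A(l) v = -D₀* (exp (-l x₁) f)`, where `D₀` is the inclusion into
`L²(Ω₀)` and `A(l)` (`gaugedOperator`) is a quadratic polynomial in `l`
(`isQPSolution_gaugeCell_iff`).

For large real `s` the operator `A(l) + s D₀* D₀` is coercive, hence invertible, and `D₀` is
compact. So `A(l)` is an invertible operator times identity minus compact, and it is invertible as
soon as it is injective (`isUnit_gaugedOperator`). A kernel element would be a nontrivial solution
of the homogeneous problem, so `A(l)` is invertible whenever `exp l` is not a Floquet multiplier.
Inversion is holomorphic on the invertible operators, so the solution operator is holomorphic in `l`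
in operator norm. A continuous logarithm of an analytic curve is analytic, and composition gives an
operator-valued analytic function of `t`. Its derivatives are bounded in norm on the compact
interval, and evaluation at `f` commutes with `∂_t`; this makes the constants independent of `f` and
`t`.

Compactness of `D₀` is proved by Fourier series, with exponentials in `x₁` and cosines in `x₂`. The
cosines are complete by Stone-Weierstrass on a cylinder. The coefficients of `∂₁u` against them, and
of `∂₂u` against exponential times sine, are those of `u` times the frequency. The sines vanish on
the walls, so no trace of `u` enters. Bessel's inequality then bounds the high-frequency part of `u`
by `‖u‖ / N`, and `D₀` is a norm limit of finite-rank operators. Since weak derivatives are tested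
only in the open guide, the integrations by parts come from cutoffs near the walls and a partition
of unity along the guide. -/

/-! ### Calculus of weak derivatives -/

theorem integrableOn_mul_test {O : Set (ℝ × ℝ)} {g : ℝ × ℝ → ℂ}
    (hg : LocallyIntegrableOn g O) {φ : ℝ × ℝ → ℂ} (hφ : Continuous φ)
    (hc : HasCompactSupport φ) (hs : tsupport φ ⊆ O) :
    IntegrableOn (fun x => φ x * g x) O := by
  have h1 : IntegrableOn g (tsupport φ) := hg.integrableOn_compact_subset hs hc
  have h2 : IntegrableOn (fun x => φ x * g x) (tsupport φ) :=
    h1.continuousOn_mul hφ.continuousOn hc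
  have h3 : Integrable (fun x => φ x * g x) := by
    rw [← integrableOn_iff_integrable_of_support_subset (s := tsupport φ)]
    · exact h2
    · intro x hx
      refine subset_tsupport φ ?_
      intro h0
      exact hx (by simp [h0])
  exact h3.integrableOn

theorem tsupport_comp_subset_of_map_zero {X A B : Type*} [TopologicalSpace X] [Zero A] [Zero B]
    {L : A → B} (hL : L 0 = 0) (ψ : X → A) : tsupport (fun x => L (ψ x)) ⊆ tsupport ψ :=
  closure_mono fun x hx h0 => hx (by simp [h0, hL])

/-- A weak derivative may be tested with complex valued functions. -/
theorem HasWeakPartial.integral_complex {O : Set (ℝ × ℝ)} {e : ℝ × ℝ} {g h : ℝ × ℝ → ℂ}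
    (H : HasWeakPartial O e g h) {ψ : ℝ × ℝ → ℂ} (h1 : ContDiff ℝ ∞ ψ)
    (h2 : HasCompactSupport ψ) (h3 : tsupport ψ ⊆ O) :
    ∫ x in O, fderiv ℝ ψ x e * g x = -∫ x in O, ψ x * h x := by
  have hdiff : ∀ x, DifferentiableAt ℝ ψ x := fun x => (h1.differentiable (by simp)) x
  -- Used with `L` the real and the imaginary part, each of which gives a real test function.
  have key : ∀ L : ℂ →L[ℝ] ℝ,
      ∫ x in O, (L (fderiv ℝ ψ x e)) • g x = -∫ x in O, (L (ψ x)) • h x := by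
    intro L
    have e1 : ∀ x, fderiv ℝ (fun y => L (ψ y)) x e = L (fderiv ℝ ψ x e) := fun x => by
      have := (L.hasFDerivAt.comp x (hdiff x).hasFDerivAt).fderiv
      rw [show (fun y => L (ψ y)) = L ∘ ψ from rfl, this]
      rfl
    have := H.2.2 (fun y => L (ψ y)) (L.contDiff.comp h1) (h2.comp_left L.map_zero)
      ((tsupport_comp_subset_of_map_zero L.map_zero ψ).trans h3)
    simpa only [e1] using this
  have hint : ∀ (L : ℂ →L[ℝ] ℝ) (φ : ℝ × ℝ → ℂ) (g : ℝ × ℝ → ℂ), LocallyIntegrableOn g O →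
      Continuous φ → HasCompactSupport φ → tsupport φ ⊆ O →
      IntegrableOn (fun x => (L (φ x)) • g x) O := fun L φ g hg a b c =>
    integrableOn_smul_test hg (L.continuous.comp a) (b.comp_left L.map_zero)
      ((tsupport_comp_subset_of_map_zero L.map_zero φ).trans c)
  have hd : Continuous (fun x => fderiv ℝ ψ x e) :=
    (h1.continuous_fderiv (by simp)).clm_apply continuous_const
  have hdc : HasCompactSupport (fun x => fderiv ℝ ψ x e) := h2.fderiv_apply ℝ e
  have hds : tsupport (fun x => fderiv ℝ ψ x e) ⊆ O :=
    (tsupport_fderiv_apply_subset ℝ e).trans h3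
  have split : ∀ (φ g : ℝ × ℝ → ℂ), LocallyIntegrableOn g O →
      Continuous φ → HasCompactSupport φ → tsupport φ ⊆ O →
      ∫ x in O, φ x * g x = (∫ x in O, (Complex.reCLM (φ x)) • g x)
        + Complex.I * ∫ x in O, (Complex.imCLM (φ x)) • g x := by
    intro φ g hg a b c
    rw [← integral_const_mul, ← integral_add (hint _ φ g hg a b c)
      ((hint _ φ g hg a b c).const_mul _)]
    congr 1
    ext x
    simp only [Complex.reCLM_apply, Complex.imCLM_apply, Complex.real_smul]
    conv_lhs => rw [← Complex.re_add_im (φ x)]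
    ring
  rw [split _ g H.1 hd hdc hds, split ψ h H.2.1 h1.continuous h2 h3, key, key]
  ring

/-- The product rule for a weak derivative and a smooth function. -/
theorem HasWeakPartial.smooth_mul {O : Set (ℝ × ℝ)} (hO : IsOpen O) {e : ℝ × ℝ}
    {g h : ℝ × ℝ → ℂ} (H : HasWeakPartial O e g h) {φ : ℝ × ℝ → ℂ} (hφ : ContDiff ℝ ∞ φ) :
    HasWeakPartial O e (fun x => φ x * g x) (fun x => φ x * h x + fderiv ℝ φ x e * g x) := by
  have hdφ : Continuous (fun x => fderiv ℝ φ x e) :=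
    (hφ.continuous_fderiv (by simp)).clm_apply continuous_const
  have a1 : LocallyIntegrableOn (fun x => φ x * g x) O :=
    H.1.continuousOn_mul hφ.continuous.continuousOn hO.isLocallyClosed
  have a2 : LocallyIntegrableOn (fun x => φ x * h x) O :=
    H.2.1.continuousOn_mul hφ.continuous.continuousOn hO.isLocallyClosed
  have a3 : LocallyIntegrableOn (fun x => fderiv ℝ φ x e * g x) O :=
    H.1.continuousOn_mul hdφ.continuousOn hO.isLocallyClosed
  refine ⟨a1, a2.add a3, fun ψ h1 h2 h3 => ?_⟩
  have hψc : ContDiff ℝ ∞ (fun x => (ψ x : ℂ)) := Complex.ofRealCLM.contDiff.comp h1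
  have hs : tsupport (fun x => (ψ x : ℂ) * φ x) ⊆ O :=
    ((tsupport_mul_subset_left).trans
      (tsupport_comp_subset_of_map_zero (L := ((↑) : ℝ → ℂ)) (by simp) ψ)).trans h3
  have hcs : HasCompactSupport (fun x => (ψ x : ℂ)) :=
    h2.comp_left (g := ((↑) : ℝ → ℂ)) (by simp)
  -- The smooth factor is moved onto the test function, which thereby becomes complex valued.
  have key := H.integral_complex (ψ := fun x => (ψ x : ℂ) * φ x) (hψc.mul hφ)
    (hcs.mul_right) hs
  have e1 : ∀ x, fderiv ℝ (fun x => (ψ x : ℂ) * φ x) x e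
      = (ψ x : ℂ) * fderiv ℝ φ x e + φ x * (fderiv ℝ ψ x e : ℝ) := by
    intro x
    have d1 : HasFDerivAt (fun x => (ψ x : ℂ)) (Complex.ofRealCLM.comp (fderiv ℝ ψ x)) x :=
      Complex.ofRealCLM.hasFDerivAt.comp x ((h1.differentiable (by simp)) x).hasFDerivAt
    have d2 := ((hφ.differentiable (by simp)) x).hasFDerivAt
    have d3 : HasFDerivAt (fun x => (ψ x : ℂ) * φ x) _ x := d1.mul d2
    rw [d3.fderiv]
    simp
  have hd : Continuous (fun x => fderiv ℝ ψ x e) :=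
    (h1.continuous_fderiv (by simp)).clm_apply continuous_const
  have i1 := integrableOn_smul_test a1 hd (h2.fderiv_apply ℝ e)
    ((tsupport_fderiv_apply_subset ℝ e).trans h3)
  have i2 := integrableOn_smul_test a2 h1.continuous h2 h3
  have i3 := integrableOn_smul_test a3 h1.continuous h2 h3
  simp only [smul_add]
  rw [integral_add i2 i3]
  have e2 : ∫ x in O, fderiv ℝ (fun x => (ψ x : ℂ) * φ x) x e * g x
      = (∫ x in O, ψ x • (fderiv ℝ φ x e * g x)) + ∫ x in O, (fderiv ℝ ψ x e) • (φ x * g x) := by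
    rw [← integral_add i3 i1]
    congr 1
    ext x
    rw [e1, Complex.real_smul, Complex.real_smul]
    ring
  have e3 : ∫ x in O, (ψ x : ℂ) * φ x * h x = ∫ x in O, ψ x • (φ x * h x) := by
    congr 1
    ext x
    rw [Complex.real_smul]
    ring
  rw [e2, e3] at key
  linear_combination key

/-- Needed to pass from the bilinear weak formulation to a sesquilinear form on a Hilbert space. -/
theorem HasWeakPartial.star {O : Set (ℝ × ℝ)} {e : ℝ × ℝ} {g h : ℝ × ℝ → ℂ}
    (H : HasWeakPartial O e g h) :
    HasWeakPartial O e (fun x => starRingEnd ℂ (g x)) (fun x => starRingEnd ℂ (h x)) := by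
  have aux : ∀ f : ℝ × ℝ → ℂ, LocallyIntegrableOn f O →
      LocallyIntegrableOn (fun x => starRingEnd ℂ (f x)) O := fun f hf x hx => by
    obtain ⟨s, hs, hi⟩ := hf x hx
    exact ⟨s, hs, Complex.conjCLE.toContinuousLinearMap.integrable_comp hi⟩
  refine ⟨aux g H.1, aux h H.2.1, fun ψ h1 h2 h3 => ?_⟩
  have e1 : ∀ (r : ℝ) (y : ℂ), r • starRingEnd ℂ y = starRingEnd ℂ (r • y) := fun r y => by
    simp [Complex.real_smul]
  simp only [e1, integral_conj]
  rw [H.2.2 ψ h1 h2 h3, map_neg]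

/-! ### Folding integrals over the guide back to the cell -/

theorem isOpen_guideInterior : IsOpen guideInterior := isOpen_univ.prod isOpen_Ioo

theorem isOpen_cellInterior : IsOpen cellInterior := isOpen_Ioo.prod isOpen_Ioo

theorem measurableSet_cell : MeasurableSet cell := measurableSet_Ioc.prod measurableSet_Icc

instance : IsFiniteMeasure (volume.restrict cell) := by
  refine ⟨?_⟩
  rw [Measure.restrict_apply_univ]
  refine lt_of_le_of_lt (measure_mono (prod_mono Ioc_subset_Icc_self subset_rfl))
    (isCompact_Icc.prod isCompact_Icc).measure_lt_top

theorem L2Cell.integrable (g : L2Cell) : Integrable g (volume.restrict cell) :=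
  (Lp.memLp g).integrable (by norm_num)

theorem cell_ae_eq : (cell : Set (ℝ × ℝ)) =ᵐ[volume] Ioc (-1 / 2) (1 / 2) ×ˢ Ioo (0 : ℝ) 1 :=
  Measure.set_prod_ae_eq (ae_eq_refl _) Ioo_ae_eq_Icc.symm

theorem cell_ae_eq_cellInterior : (cell : Set (ℝ × ℝ)) =ᵐ[volume] cellInterior :=
  Measure.set_prod_ae_eq Ioo_ae_eq_Ioc.symm Ioo_ae_eq_Icc.symm

/-- The translate of the cell by `n`. -/
def cellShift (n : ℤ) : Set (ℝ × ℝ) := {x | (x.1 - n, x.2) ∈ cell}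

theorem measurableSet_cellShift (n : ℤ) : MeasurableSet (cellShift n) :=
  measurableSet_cell.preimage (by fun_prop)

theorem ceil_of_mem_cellShift {n : ℤ} {x : ℝ × ℝ} (hx : x ∈ cellShift n) :
    ⌈x.1 - 1 / 2⌉ = n := by
  have h1 := hx.1.1
  have h2 := hx.1.2
  dsimp only at h1 h2
  rw [Int.ceil_eq_iff]
  constructor <;> linarith

theorem qpExt_of_mem_cellShift (z : ℂ) (g : ℝ × ℝ → ℂ) {n : ℤ} {x : ℝ × ℝ}
    (hx : x ∈ cellShift n) : qpExt z g x = z ^ n * g (x.1 - n, x.2) := by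
  simp only [qpExt, ceil_of_mem_cellShift hx]

theorem measurePreserving_shift (n : ℤ) :
    MeasurePreserving (fun x : ℝ × ℝ => (x.1 - (n : ℝ), x.2)) := by
  have := measurePreserving_sub_right (volume : Measure (ℝ × ℝ)) ((n : ℝ), (0 : ℝ))
  refine this.congr (by fun_prop) (Eventually.of_forall fun x => ?_)
  ext <;> simp

theorem measurableEmbedding_shift (n : ℤ) :
    MeasurableEmbedding (fun x : ℝ × ℝ => (x.1 - (n : ℝ), x.2)) := by
  have := (MeasurableEquiv.subRight ((n : ℝ), (0 : ℝ))).measurableEmbedding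
  convert this using 1
  ext x
  · rfl
  · exact (sub_zero x.2).symm

theorem integrableOn_cellShift {g : ℝ × ℝ → ℂ} (hg : IntegrableOn g cell) (n : ℤ) :
    IntegrableOn (fun x => g (x.1 - n, x.2)) (cellShift n) :=
  ((measurePreserving_shift n).integrableOn_comp_preimage (measurableEmbedding_shift n)).2 hg

theorem setIntegral_cellShift (F : ℝ × ℝ → ℂ) (n : ℤ) :
    ∫ x in cellShift n, F x = ∫ x in cell, F (x.1 + n, x.2) := by
  rw [← (measurePreserving_shift n).setIntegral_preimage_emb (measurableEmbedding_shift n)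
    (fun x => F (x.1 + n, x.2)) cell]
  simp only [sub_add_cancel]
  rfl

theorem integrableOn_qpExt_cellShift (z : ℂ) {g : ℝ × ℝ → ℂ} (hg : IntegrableOn g cell) (n : ℤ) :
    IntegrableOn (qpExt z g) (cellShift n) := by
  refine IntegrableOn.congr_fun (f := fun x => z ^ n * g (x.1 - n, x.2))
    ((integrableOn_cellShift hg n).const_mul (z ^ n)) (fun x hx => (qpExt_of_mem_cellShift z g hx).symm) (measurableSet_cellShift n)

theorem exists_mem_cellShift {N : ℕ} {x : ℝ × ℝ} (hx : x ∈ guideInterior)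
    (h : |x.1| < N) : ∃ n ∈ Finset.Icc (-(N : ℤ)) N, x ∈ cellShift n := by
  refine ⟨⌈x.1 - 1 / 2⌉, ?_, foldBack_mem hx⟩
  rw [abs_lt] at h
  rw [Finset.mem_Icc, Int.le_ceil_iff, Int.ceil_le]
  push_cast
  constructor <;> linarith

theorem locallyIntegrableOn_qpExt (z : ℂ) {g : ℝ × ℝ → ℂ} (hg : IntegrableOn g cell) :
    LocallyIntegrableOn (qpExt z g) guideInterior := by
  intro x hx
  obtain ⟨N, hN⟩ := exists_nat_gt |x.1|
  have ho : IsOpen {y : ℝ × ℝ | |y.1| < N} := isOpen_lt (by fun_prop) (by fun_prop)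
  refine ⟨{y | |y.1| < N} ∩ guideInterior,
    inter_mem (mem_nhdsWithin_of_mem_nhds (ho.mem_nhds hN)) self_mem_nhdsWithin, ?_⟩
  have : IntegrableOn (qpExt z g) (⋃ n ∈ Finset.Icc (-(N : ℤ)) N, cellShift n) :=
    integrableOn_finset_iUnion.2 fun n _ => integrableOn_qpExt_cellShift z hg n
  refine this.mono_set fun y hy => ?_
  obtain ⟨n, hn, hy'⟩ := exists_mem_cellShift hy.2 hy.1
  exact mem_biUnion hn hy'

/-- Only the walls, a null set, are lost. -/
theorem cellShift_ae_eq (n : ℤ) :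
    (cellShift n ∩ guideInterior : Set (ℝ × ℝ)) =ᵐ[volume] cellShift n := by
  have h := (measurePreserving_shift n).quasiMeasurePreserving.preimage_ae_eq cell_ae_eq
  refine EventuallyEq.trans ?_ h.symm
  refine Eventually.of_forall fun x => ?_
  apply propext
  constructor
  · rintro ⟨h1, h2⟩
    exact ⟨h1.1, h2.2⟩
  · rintro ⟨h1, h2⟩
    exact ⟨⟨h1, Ioo_subset_Icc_self h2⟩, trivial, h2⟩

/-- An integral over the guide, folded back to the periodicity cell. -/
theorem setIntegral_guideInterior {F : ℝ × ℝ → ℂ} (hF : IntegrableOn F guideInterior) {N : ℕ}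
    (h0 : ∀ x, (N : ℝ) ≤ |x.1| → F x = 0) :
    ∫ x in guideInterior, F x
      = ∑ n ∈ Finset.Icc (-(N : ℤ)) N, ∫ x in cell, F (x.1 + n, x.2) := by
  have e1 : ∫ x in guideInterior, F x
      = ∫ x in ⋃ n ∈ Finset.Icc (-(N : ℤ)) N, (cellShift n ∩ guideInterior), F x := by
    refine setIntegral_eq_of_subset_of_forall_sdiff_eq_zero isOpen_guideInterior.measurableSet
      ?_ ?_
    · exact iUnion₂_subset fun n _ => inter_subset_right
    · rintro x ⟨hx, hx'⟩
      refine h0 x ?_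
      by_contra hlt
      obtain ⟨n, hn, hy⟩ := exists_mem_cellShift hx (not_le.1 hlt)
      exact hx' (mem_biUnion hn ⟨hy, hx⟩)
  rw [e1, integral_biUnion_finset]
  · refine Finset.sum_congr rfl fun n _ => ?_
    rw [setIntegral_congr_set (cellShift_ae_eq n), setIntegral_cellShift]
  · exact fun n _ => (measurableSet_cellShift n).inter isOpen_guideInterior.measurableSet
  · intro n _ m _ hnm
    refine disjoint_left.2 fun x hx hx' => hnm ?_
    rw [← ceil_of_mem_cellShift hx.1, ceil_of_mem_cellShift hx'.1]
  · exact fun n _ => hF.mono_set inter_subset_right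

theorem exists_bound_on_cell {φ : ℝ × ℝ → ℂ} (hφ : Continuous φ) : ∃ K, ∀ x ∈ cell, ‖φ x‖ ≤ K := by
  have hK : IsCompact (Icc (-1 / 2 : ℝ) (1 / 2) ×ˢ Icc (0 : ℝ) 1) :=
    isCompact_Icc.prod isCompact_Icc
  obtain ⟨K, hK⟩ := hK.exists_bound_of_continuousOn hφ.continuousOn
  exact ⟨K, fun x hx => hK x ⟨Ioc_subset_Icc_self hx.1, hx.2⟩⟩

theorem memLp_cell {φ : ℝ × ℝ → ℂ} (hφ : Continuous φ) (p : ENNReal) :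
    MemLp φ p (volume.restrict cell) := by
  obtain ⟨K, hK⟩ := exists_bound_on_cell hφ
  exact MemLp.of_bound hφ.aestronglyMeasurable K
    ((ae_restrict_iff' measurableSet_cell).2 (Eventually.of_forall hK))

/-- The class in `L²(Ω₀)` of a continuous function. -/
def ofCont (φ : ℝ × ℝ → ℂ) (hφ : Continuous φ) : L2Cell := (memLp_cell hφ 2).toLp φ

theorem coeFn_ofCont {φ : ℝ × ℝ → ℂ} (hφ : Continuous φ) :
    ofCont φ hφ =ᵐ[volume.restrict cell] φ := MemLp.coeFn_toLp _

theorem inner_ofCont {φ : ℝ × ℝ → ℂ} (hφ : Continuous φ) (g : L2Cell) :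
    inner ℂ (ofCont φ hφ) g = ∫ x in cell, starRingEnd ℂ (φ x) * g x := by
  rw [L2.inner_def]
  refine integral_congr_ae ?_
  filter_upwards [coeFn_ofCont hφ] with x hx
  rw [hx, RCLike.inner_apply, mul_comm]

theorem continuous_integral_cell {φ : ℝ × ℝ → ℂ} (hφ : Continuous φ) :
    Continuous fun g : L2Cell => ∫ x in cell, φ x * g x := by
  have h : (fun g : L2Cell => ∫ x in cell, φ x * g x)
      = fun g => inner ℂ (ofCont (fun x => starRingEnd ℂ (φ x)) (by fun_prop)) g := by
    ext g
    simp [inner_ofCont]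
  rw [h]
  fun_prop

theorem integrable_mul_cell {φ : ℝ × ℝ → ℂ} (hφ : Continuous φ) (g : L2Cell) :
    IntegrableOn (fun x => φ x * g x) cell := by
  obtain ⟨K, hK⟩ := exists_bound_on_cell hφ
  exact (L2Cell.integrable g).bdd_mul hφ.aestronglyMeasurable
    ((ae_restrict_iff' measurableSet_cell).2 (Eventually.of_forall hK))

/-- Folding moves the quasi-periodicity onto the test function as a finite weighted sum of
translates. The pairing becomes an integral of `g` over the cell against a continuous function,
hence is continuous in `g`. -/
theorem setIntegral_guideInterior_qpExt {ψ : ℝ × ℝ → ℂ} (hψ : Continuous ψ)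
    (hc : HasCompactSupport ψ) (hs : tsupport ψ ⊆ guideInterior) {N : ℕ}
    (h0 : ∀ x, (N : ℝ) ≤ |x.1| → ψ x = 0) (z : ℂ) (g : L2Cell) :
    ∫ x in guideInterior, ψ x * qpExt z g x
      = ∫ x in cell, (∑ n ∈ Finset.Icc (-(N : ℤ)) N, ψ (x.1 + n, x.2) * z ^ n) * g x := by
  rw [setIntegral_guideInterior
    (integrableOn_mul_test (locallyIntegrableOn_qpExt z (L2Cell.integrable g)) hψ hc hs) (N := N)
    (fun x hx => by rw [h0 x hx, zero_mul])]
  simp only [Finset.sum_mul]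
  rw [integral_finsetSum]
  · refine Finset.sum_congr rfl fun n _ => setIntegral_congr_fun measurableSet_cell fun x hx => ?_
    simp only [qpExt_spec z g x hx n]
    ring
  · exact fun n _ => integrable_mul_cell (by fun_prop) g

/-! ### Completeness of the Sobolev spaces -/

theorem exists_bound_fst_of_hasCompactSupport {ψ : ℝ × ℝ → ℂ} (hc : HasCompactSupport ψ) :
    ∃ N : ℕ, ∀ x, (N : ℝ) ≤ |x.1| → ψ x = 0 := by
  obtain ⟨R, hR⟩ := hc.isBounded.exists_norm_le
  obtain ⟨N, hN⟩ := exists_nat_gt R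
  refine ⟨N, fun x hx => ?_⟩
  by_contra h
  have h1 := hR x (subset_tsupport ψ h)
  have h2 : |x.1| ≤ ‖x‖ := norm_fst_le x
  linarith

theorem continuous_integral_guideInterior {ψ : ℝ × ℝ → ℝ} (hψ : Continuous ψ)
    (hc : HasCompactSupport ψ) (hs : tsupport ψ ⊆ guideInterior) (z : ℂ) :
    Continuous fun g : L2Cell => ∫ x in guideInterior, ψ x • qpExt z g x := by
  have hc' : HasCompactSupport (fun x => (ψ x : ℂ)) :=
    hc.comp_left (g := ((↑) : ℝ → ℂ)) (by simp)
  obtain ⟨N, hN⟩ := exists_bound_fst_of_hasCompactSupport hc'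
  have h := fun g : L2Cell => setIntegral_guideInterior_qpExt (ψ := fun x => (ψ x : ℂ))
    (by fun_prop) hc' ((tsupport_comp_subset_of_map_zero (L := ((↑) : ℝ → ℂ)) (by simp) ψ).trans hs)
    hN z g
  simp only [Complex.real_smul, h]
  exact continuous_integral_cell (by fun_prop)

theorem continuous_integral_cellInterior {ψ : ℝ × ℝ → ℝ} (hψ : Continuous ψ) :
    Continuous fun g : L2Cell => ∫ x in cellInterior, ψ x • (g : ℝ × ℝ → ℂ) x := by
  simp only [← setIntegral_congr_set cell_ae_eq_cellInterior, Complex.real_smul]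
  exact continuous_integral_cell (by fun_prop)

/-- Each test function imposes one closed condition on the pair, and local integrability holds for
every pair. `Φ` is the identity for `H¹(Ω₀)` and the extension `qpExt z` for `H¹_z(Ω₀)`. -/
theorem isClosed_hasWeakPartial {O : Set (ℝ × ℝ)} {e : ℝ × ℝ} {Φ : L2Cell → ℝ × ℝ → ℂ}
    (hloc : ∀ g, LocallyIntegrableOn (Φ g) O)
    (hcont : ∀ ψ : ℝ × ℝ → ℝ, Continuous ψ → HasCompactSupport ψ → tsupport ψ ⊆ O →
      Continuous fun g : L2Cell => ∫ x in O, ψ x • Φ g x) :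
    IsClosed {p : L2Cell × L2Cell | HasWeakPartial O e (Φ p.1) (Φ p.2)} := by
  have : {p : L2Cell × L2Cell | HasWeakPartial O e (Φ p.1) (Φ p.2)}
      = ⋂ (ψ : ℝ × ℝ → ℝ) (_ : ContDiff ℝ ∞ ψ) (_ : HasCompactSupport ψ) (_ : tsupport ψ ⊆ O),
        {p | ∫ x in O, (fderiv ℝ ψ x e) • Φ p.1 x = -∫ x in O, ψ x • Φ p.2 x} := by
    ext p
    simp only [mem_ofPred_eq, mem_iInter]
    exact ⟨fun h => h.2.2, fun h => ⟨hloc _, hloc _, h⟩⟩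
  rw [this]
  refine isClosed_iInter fun ψ => isClosed_iInter fun h1 => isClosed_iInter fun h2 =>
    isClosed_iInter fun h3 => isClosed_eq ?_ ?_
  · exact (hcont _ ((h1.continuous_fderiv (by simp)).clm_apply continuous_const)
      (h2.fderiv_apply ℝ e) ((tsupport_fderiv_apply_subset ℝ e).trans h3)).comp continuous_fst
  · exact ((hcont ψ h1.continuous h2 h3).comp continuous_snd).neg

theorem isClosed_H1Cell : IsClosed (H1Cell : Set L2Triple) := by
  have h : ∀ e, IsClosed {p : L2Cell × L2Cell | HasWeakPartial cellInterior e p.1 p.2} := fun e =>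
    isClosed_hasWeakPartial (Φ := fun g => (g : ℝ × ℝ → ℂ))
      (fun g => (IntegrableOn.locallyIntegrableOn
        ((L2Cell.integrable g).mono_measure (Measure.restrict_mono cellInterior_subset_cell le_rfl))))
      (fun ψ h1 _ _ => continuous_integral_cellInterior h1)
  have c : ∀ i : Fin 3, Continuous fun u : L2Triple => u i := fun i =>
    (PiLp.proj (𝕜 := ℂ) 2 (fun _ : Fin 3 => L2Cell) i).continuous
  exact ((h (1, 0)).preimage ((c 0).prodMk (c 1))).inter
    ((h (0, 1)).preimage ((c 0).prodMk (c 2)))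

theorem isClosed_H1qp (z : ℂ) : IsClosed (H1qp z : Set H1Cell) := by
  have h : ∀ e, IsClosed {p : L2Cell × L2Cell |
      HasWeakPartial guideInterior e (qpExt z p.1) (qpExt z p.2)} := fun e =>
    isClosed_hasWeakPartial (Φ := fun g => qpExt z g)
      (fun g => locallyIntegrableOn_qpExt z (L2Cell.integrable g))
      (fun ψ h1 h2 h3 => continuous_integral_guideInterior h1 h2 h3 z)
  have c : ∀ i : Fin 3, Continuous fun u : H1Cell => (u : L2Triple) i := fun i =>
    (PiLp.proj (𝕜 := ℂ) 2 (fun _ : Fin 3 => L2Cell) i).continuous.comp continuous_subtype_val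
  exact ((h (1, 0)).preimage ((c 0).prodMk (c 1))).inter
    ((h (0, 1)).preimage ((c 0).prodMk (c 2)))

instance : CompleteSpace H1Cell := isClosed_H1Cell.completeSpace_coe

instance (z : ℂ) : CompleteSpace (H1qp z) := (isClosed_H1qp z).completeSpace_coe

/-! ### Integration by parts for periodic functions -/

/-- A smooth function on the line whose integer translates add up to `1`. -/
def unitBump (t : ℝ) : ℝ := Real.smoothTransition (t + 1 / 2) - Real.smoothTransition (t - 1 / 2)

theorem contDiff_unitBump : ContDiff ℝ ∞ unitBump :=
  (Real.smoothTransition.contDiff.comp (by fun_prop)).sub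
    (Real.smoothTransition.contDiff.comp (by fun_prop))

theorem unitBump_of_lt {t : ℝ} (h : t < -1 / 2) : unitBump t = 0 := by
  rw [unitBump, Real.smoothTransition.zero_of_nonpos (by linarith),
    Real.smoothTransition.zero_of_nonpos (by linarith), sub_zero]

theorem unitBump_of_gt {t : ℝ} (h : 3 / 2 < t) : unitBump t = 0 := by
  rw [unitBump, Real.smoothTransition.one_of_one_le (by linarith),
    Real.smoothTransition.one_of_one_le (by linarith), sub_self]

/-- The sum telescopes. It holds on an open interval containing `[-1/2, 1/2]`, so it can be
differentiated at every point of the cell. -/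
theorem sum_unitBump {t : ℝ} (h : t ∈ Ioo (-1 : ℝ) 1) :
    ∑ n ∈ Finset.Icc (-((2 : ℕ) : ℤ)) ((2 : ℕ) : ℤ), unitBump (t + n) = 1 := by
  have e : Finset.Icc (-((2 : ℕ) : ℤ)) ((2 : ℕ) : ℤ) = {-2, -1, 0, 1, 2} := by decide
  rw [e]
  simp only [unitBump]
  rw [Finset.sum_insert (by decide), Finset.sum_insert (by decide), Finset.sum_insert (by decide),
    Finset.sum_insert (by decide), Finset.sum_singleton]
  push_cast
  have h1 : Real.smoothTransition (t + -2 - 1 / 2) = 0 :=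
    Real.smoothTransition.zero_of_nonpos (by linarith [h.2])
  have h2 : Real.smoothTransition (t + 2 + 1 / 2) = 1 :=
    Real.smoothTransition.one_of_one_le (by linarith [h.1])
  rw [h1, h2, show t + -2 + 1 / 2 = t + -1 - 1 / 2 by ring,
    show t + -1 + 1 / 2 = t + 0 - 1 / 2 by ring, show t + 0 + 1 / 2 = t + 1 - 1 / 2 by ring,
    show t + 1 + 1 / 2 = t + 2 - 1 / 2 by ring]
  ring

theorem periodic_int {P : ℝ × ℝ → ℂ} (hper : ∀ x, P (x.1 + 1, x.2) = P x) (n : ℤ) (x : ℝ × ℝ) :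
    P (x.1 + n, x.2) = P x := by
  have h : Function.Periodic (fun t => P (t, x.2)) 1 := fun t => hper (t, x.2)
  simpa using h.int_mul n x.1

/-- Integration by parts over the cell for a periodic function against a periodic smooth function
that vanishes near the walls. -/
theorem integral_by_parts_of_compact {e : ℝ × ℝ} {g h : L2Cell}
    (H : HasWeakPartial guideInterior e (qpExt 1 g) (qpExt 1 h)) {P : ℝ × ℝ → ℂ}
    (hP : ContDiff ℝ ∞ P) (hper : ∀ x, P (x.1 + 1, x.2) = P x) {δ : ℝ} (hδ : 0 < δ)
    (h0 : ∀ x, x.2 ∉ Icc δ (1 - δ) → P x = 0) :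
    ∫ x in cell, fderiv ℝ P x e * g x = -∫ x in cell, P x * h x := by
  -- The bump makes the periodic `P` an admissible test function; on folding back, the translates of
  -- `ψ` add up to `P` again.
  set ψ : ℝ × ℝ → ℂ := fun x => (unitBump x.1 : ℂ) * P x with hψdef
  have hψ : ContDiff ℝ ∞ ψ :=
    (Complex.ofRealCLM.contDiff.comp (contDiff_unitBump.comp contDiff_fst)).mul hP
  set K : Set (ℝ × ℝ) := Icc (-1 / 2) (3 / 2) ×ˢ Icc δ (1 - δ) with hK
  have hKc : IsCompact K := isCompact_Icc.prod isCompact_Icc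
  have hzero : ∀ x, x ∉ K → ψ x = 0 := by
    intro x hx
    by_cases hx2 : x.2 ∈ Icc δ (1 - δ)
    · have hx1 : x.1 ∉ Icc (-1 / 2 : ℝ) (3 / 2) := fun h1 => hx ⟨h1, hx2⟩
      rw [mem_Icc, not_and_or, not_le, not_le] at hx1
      rcases hx1 with h1 | h1
      · simp [hψdef, unitBump_of_lt h1]
      · simp [hψdef, unitBump_of_gt h1]
    · simp [hψdef, h0 x hx2]
  have hts : tsupport ψ ⊆ K := closure_minimal (fun x hx => by
    by_contra h1; exact hx (hzero x h1)) hKc.isClosed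
  have hKg : K ⊆ guideInterior := fun x hx =>
    ⟨trivial, by linarith [hx.2.1], by linarith [hx.2.2]⟩
  have hc : HasCompactSupport ψ := HasCompactSupport.intro hKc hzero
  have key := H.integral_complex hψ hc (hts.trans hKg)
  have hd : Continuous (fun x => fderiv ℝ ψ x e) :=
    (hψ.continuous_fderiv (by simp)).clm_apply continuous_const
  have hout : ∀ x : ℝ × ℝ, ((2 : ℕ) : ℝ) ≤ |x.1| → x ∉ K := by
    intro x hx hxK
    have h1 := hxK.1.1
    have h2 := hxK.1.2
    have h3 : |x.1| ≤ 3 / 2 := abs_le.2 ⟨by linarith, h2⟩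
    push_cast at hx
    linarith
  rw [setIntegral_guideInterior_qpExt hd (hc.fderiv_apply ℝ e)
      (((tsupport_fderiv_apply_subset ℝ e).trans hts).trans hKg) (N := 2)
      (fun x hx => by
        by_contra h1
        exact hout x hx (hts (tsupport_fderiv_apply_subset ℝ e (subset_tsupport _ h1)))),
    setIntegral_guideInterior_qpExt hψ.continuous hc (hts.trans hKg) (N := 2)
      (fun x hx => hzero x (hout x hx))] at key
  have hsum : ∀ x : ℝ × ℝ, x.1 ∈ Ioo (-1 : ℝ) 1 →
      ∑ n ∈ Finset.Icc (-((2 : ℕ) : ℤ)) ((2 : ℕ) : ℤ), ψ (x.1 + n, x.2) = P x := by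
    intro x hx
    simp only [hψdef, periodic_int hper]
    rw [← Finset.sum_mul, ← Complex.ofReal_sum, sum_unitBump hx, Complex.ofReal_one, one_mul]
  have hmem : ∀ x ∈ cell, x.1 ∈ Ioo (-1 : ℝ) 1 := fun x hx =>
    ⟨by linarith [hx.1.1], by linarith [hx.1.2]⟩
  have hdsum : ∀ x ∈ cell,
      ∑ n ∈ Finset.Icc (-((2 : ℕ) : ℤ)) ((2 : ℕ) : ℤ), fderiv ℝ ψ (x.1 + n, x.2) e
        = fderiv ℝ P x e := by
    intro x hx
    have hev : (fun y : ℝ × ℝ => ∑ n ∈ Finset.Icc (-((2 : ℕ) : ℤ)) ((2 : ℕ) : ℤ),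
        ψ (y + ((n : ℝ), (0 : ℝ)))) =ᶠ[𝓝 x] P := by
      have ho : IsOpen {y : ℝ × ℝ | y.1 ∈ Ioo (-1 : ℝ) 1} := isOpen_Ioo.preimage continuous_fst
      filter_upwards [ho.mem_nhds (hmem x hx)] with y hy
      rw [← hsum y hy]
      refine Finset.sum_congr rfl fun n _ => congrArg ψ ?_
      ext <;> simp
    rw [← hev.fderiv_eq, fderiv_fun_sum, sum_apply]
    · refine Finset.sum_congr rfl fun n _ => ?_
      rw [fderiv_comp_add_right]
      congr 2
      ext <;> simp
    · intro n _
      exact ((hψ.differentiable (by simp)) _).comp x (by fun_prop)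
  simp only [one_zpow, mul_one] at key
  rw [setIntegral_congr_fun measurableSet_cell (g := fun x => fderiv ℝ P x e * g x)
      (fun x hx => by simp only; rw [hdsum x hx]),
    setIntegral_congr_fun (f := fun x => (∑ n ∈ Finset.Icc (-((2 : ℕ) : ℤ)) ((2 : ℕ) : ℤ),
        ψ (x.1 + n, x.2)) * h x) measurableSet_cell (g := fun x => P x * h x)
      (fun x hx => by simp only; rw [hsum x (hmem x hx)])] at key
  exact key

/-! ### Cutoffs near the walls -/

theorem deriv_smoothTransition_of_lt {t : ℝ} (h : t < 0) : deriv Real.smoothTransition t = 0 := by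
  have : Real.smoothTransition =ᶠ[𝓝 t] fun _ => 0 := by
    filter_upwards [gt_mem_nhds h] with s hs
    exact Real.smoothTransition.zero_of_nonpos hs.le
  rw [this.deriv_eq, deriv_const]

theorem deriv_smoothTransition_of_gt {t : ℝ} (h : 1 < t) : deriv Real.smoothTransition t = 0 := by
  have : Real.smoothTransition =ᶠ[𝓝 t] fun _ => 1 := by
    filter_upwards [lt_mem_nhds h] with s hs
    exact Real.smoothTransition.one_of_one_le hs.le
  rw [this.deriv_eq, deriv_const]

theorem exists_bound_deriv_smoothTransition : ∃ M, ∀ t, |deriv Real.smoothTransition t| ≤ M := by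
  have hc : Continuous (deriv Real.smoothTransition) :=
    (Real.smoothTransition.contDiff (n := 1)).continuous_deriv le_rfl
  obtain ⟨M, hM⟩ := (isCompact_Icc (a := (0 : ℝ)) (b := 1)).exists_bound_of_continuousOn
    hc.continuousOn
  refine ⟨M, fun t => ?_⟩
  have hM0 : 0 ≤ M := (norm_nonneg _).trans (hM 0 (by simp))
  rcases lt_or_ge t 0 with h | h
  · rwa [deriv_smoothTransition_of_lt h, abs_zero]
  rcases lt_or_ge 1 t with h' | h'
  · rwa [deriv_smoothTransition_of_gt h', abs_zero]
  exact hM t ⟨h, h'⟩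

/-- Smooth cutoff functions on `(0, 1)` that exhaust the interval. -/
def wallCutoff (j : ℕ) (t : ℝ) : ℝ :=
  Real.smoothTransition ((j + 1) * t - 1) * Real.smoothTransition ((j + 1) * (1 - t) - 1)

theorem contDiff_wallCutoff (j : ℕ) : ContDiff ℝ ∞ (wallCutoff j) :=
  (Real.smoothTransition.contDiff.comp (by fun_prop)).mul
    (Real.smoothTransition.contDiff.comp (by fun_prop))

theorem wallCutoff_eq_zero (j : ℕ) {t : ℝ} (h : t ∉ Icc (1 / ((j : ℝ) + 1)) (1 - 1 / (j + 1))) :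
    wallCutoff j t = 0 := by
  have hj : (0 : ℝ) < j + 1 := by positivity
  rw [mem_Icc, not_and_or, not_le, not_le] at h
  rcases h with h | h
  · rw [lt_div_iff₀ hj] at h
    rw [wallCutoff, Real.smoothTransition.zero_of_nonpos (by linarith), zero_mul]
  · have : 1 - t < 1 / (j + 1) := by linarith
    rw [lt_div_iff₀ hj] at this
    rw [wallCutoff, Real.smoothTransition.zero_of_nonpos (x := (j + 1) * (1 - t) - 1) (by linarith),
      mul_zero]

theorem abs_wallCutoff_le (j : ℕ) (t : ℝ) : |wallCutoff j t| ≤ 1 := by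
  rw [wallCutoff, abs_mul, abs_of_nonneg (Real.smoothTransition.nonneg _),
    abs_of_nonneg (Real.smoothTransition.nonneg _)]
  exact mul_le_one₀ (Real.smoothTransition.le_one _) (Real.smoothTransition.nonneg _)
    (Real.smoothTransition.le_one _)

/-- Beyond `2` the argument `(j + 1) * s - 1` exceeds `1`, where the transition is locally constant:
this settles the cutoff and its derivative at once. -/
theorem eventually_two_lt {s : ℝ} (hs : 0 < s) : ∀ᶠ j : ℕ in atTop, 2 < ((j : ℝ) + 1) * s := by
  have h := (tendsto_natCast_atTop_atTop (R := ℝ)).eventually_gt_atTop (2 / s)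
  filter_upwards [h] with j hj
  rw [div_lt_iff₀ hs] at hj
  nlinarith

theorem tendsto_wallCutoff {t : ℝ} (ht : t ∈ Ioo (0 : ℝ) 1) :
    Tendsto (fun j => wallCutoff j t) atTop (𝓝 1) := by
  refine tendsto_const_nhds.congr' ?_
  filter_upwards [eventually_two_lt ht.1, eventually_two_lt (sub_pos.2 ht.2)] with j h1 h2
  rw [wallCutoff, Real.smoothTransition.one_of_one_le (by linarith),
    Real.smoothTransition.one_of_one_le (by linarith), one_mul]

theorem deriv_wallCutoff (j : ℕ) (t : ℝ) : deriv (wallCutoff j) t =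
    (j + 1) * deriv Real.smoothTransition ((j + 1) * t - 1) *
        Real.smoothTransition ((j + 1) * (1 - t) - 1) -
      Real.smoothTransition ((j + 1) * t - 1) *
        ((j + 1) * deriv Real.smoothTransition ((j + 1) * (1 - t) - 1)) := by
  have hd : ∀ s, HasDerivAt Real.smoothTransition (deriv Real.smoothTransition s) s := fun s =>
    ((Real.smoothTransition.contDiff (n := 1)).differentiable (by simp) s).hasDerivAt
  have l1 : HasDerivAt (fun t : ℝ => ((j : ℝ) + 1) * t - 1) ((j : ℝ) + 1) t := by
    simpa using ((hasDerivAt_id t).const_mul ((j : ℝ) + 1)).sub_const 1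
  have l2 : HasDerivAt (fun t : ℝ => ((j : ℝ) + 1) * (1 - t) - 1) (-((j : ℝ) + 1)) t := by
    simpa using (((hasDerivAt_id t).const_sub 1).const_mul ((j : ℝ) + 1)).sub_const 1
  have h1 : HasDerivAt (fun t : ℝ => Real.smoothTransition ((j + 1) * t - 1)) _ t :=
    (hd _).comp t l1
  have h2 : HasDerivAt (fun t : ℝ => Real.smoothTransition ((j + 1) * (1 - t) - 1)) _ t :=
    (hd _).comp t l2
  have h3 : HasDerivAt (wallCutoff j) _ t := h1.mul h2
  rw [h3.deriv]
  ring

theorem tendsto_deriv_wallCutoff {t : ℝ} (ht : t ∈ Ioo (0 : ℝ) 1) :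
    Tendsto (fun j => deriv (wallCutoff j) t) atTop (𝓝 0) := by
  refine tendsto_const_nhds.congr' ?_
  filter_upwards [eventually_two_lt ht.1, eventually_two_lt (sub_pos.2 ht.2)] with j h1 h2
  rw [deriv_wallCutoff, deriv_smoothTransition_of_gt (by linarith),
    deriv_smoothTransition_of_gt (by linarith)]
  ring

/-- The derivative is of order `j + 1`, but only at distance at most `2 / (j + 1)` from a wall,
where the weight is of order `1 / (j + 1)`. Hence a function vanishing linearly on the walls absorbs
it uniformly in `j`. -/
theorem exists_bound_deriv_wallCutoff :
    ∃ M, ∀ j, ∀ t ∈ Ioo (0 : ℝ) 1, |deriv (wallCutoff j) t| * (t * (1 - t)) ≤ M := by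
  obtain ⟨M, hM⟩ := exists_bound_deriv_smoothTransition
  have hM0 : 0 ≤ M := (abs_nonneg _).trans (hM 0)
  have aux : ∀ (j : ℕ) (s : ℝ), 0 < s →
      (j + 1) * |deriv Real.smoothTransition ((j + 1) * s - 1)| * s ≤ 2 * M := by
    intro j s hs
    rcases lt_or_ge 1 ((j + 1) * s - 1) with h | h
    · rw [deriv_smoothTransition_of_gt h]
      simpa using hM0
    · calc (j + 1) * |deriv Real.smoothTransition ((j + 1) * s - 1)| * s
          = ((j + 1) * s) * |deriv Real.smoothTransition ((j + 1) * s - 1)| := by ring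
        _ ≤ 2 * M := mul_le_mul (by linarith) (hM _) (abs_nonneg _) (by norm_num)
  refine ⟨4 * M, fun j t ht => ?_⟩
  have h1t : 0 < 1 - t := sub_pos.2 ht.2
  have a1 := aux j t ht.1
  have a2 := aux j (1 - t) h1t
  have n1 := Real.smoothTransition.nonneg ((j + 1) * t - 1)
  have n2 := Real.smoothTransition.nonneg ((j + 1) * (1 - t) - 1)
  have m1 := Real.smoothTransition.le_one ((j + 1) * t - 1)
  have m2 := Real.smoothTransition.le_one ((j + 1) * (1 - t) - 1)
  have hj : (0 : ℝ) < j + 1 := by positivity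
  have b : |deriv (wallCutoff j) t| ≤
      (j + 1) * |deriv Real.smoothTransition ((j + 1) * t - 1)| +
        (j + 1) * |deriv Real.smoothTransition ((j + 1) * (1 - t) - 1)| := by
    rw [deriv_wallCutoff]
    refine (abs_sub _ _).trans (add_le_add ?_ ?_)
    · rw [abs_mul, abs_mul, abs_of_nonneg n2, abs_of_pos hj]
      exact mul_le_of_le_one_right (by positivity) m2
    · rw [abs_mul, abs_mul, abs_of_nonneg n1, abs_of_pos hj]
      exact mul_le_of_le_one_left (by positivity) m1
  have p1 : (j + 1) * |deriv Real.smoothTransition ((j + 1) * t - 1)| * (t * (1 - t)) ≤ 2 * M := by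
    calc _ = (j + 1) * |deriv Real.smoothTransition ((j + 1) * t - 1)| * t * (1 - t) := by ring
      _ ≤ (j + 1) * |deriv Real.smoothTransition ((j + 1) * t - 1)| * t * 1 :=
        mul_le_mul_of_nonneg_left (by linarith [ht.1])
          (mul_nonneg (by positivity) ht.1.le)
      _ ≤ 2 * M := by linarith
  have p2 : (j + 1) * |deriv Real.smoothTransition ((j + 1) * (1 - t) - 1)| * (t * (1 - t))
      ≤ 2 * M := by
    calc _ = (j + 1) * |deriv Real.smoothTransition ((j + 1) * (1 - t) - 1)| * (1 - t) * t := by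
          ring
      _ ≤ (j + 1) * |deriv Real.smoothTransition ((j + 1) * (1 - t) - 1)| * (1 - t) * 1 :=
        mul_le_mul_of_nonneg_left ht.2.le (mul_nonneg (by positivity) h1t.le)
      _ ≤ 2 * M := by linarith
  calc _ ≤ ((j + 1) * |deriv Real.smoothTransition ((j + 1) * t - 1)| +
        (j + 1) * |deriv Real.smoothTransition ((j + 1) * (1 - t) - 1)|) * (t * (1 - t)) :=
        mul_le_mul_of_nonneg_right b (mul_nonneg ht.1.le h1t.le)
    _ ≤ 4 * M := by linarith

theorem ae_cell_snd_mem : ∀ᵐ x ∂(volume.restrict cell), x ∈ cell ∧ x.2 ∈ Ioo (0 : ℝ) 1 := by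
  rw [Measure.restrict_congr_set cell_ae_eq_cellInterior]
  filter_upwards [ae_restrict_mem isOpen_cellInterior.measurableSet] with x hx
  exact ⟨cellInterior_subset_cell hx, hx.2⟩

theorem tendsto_integral_cell {F : ℕ → ℝ × ℝ → ℂ} {G : ℝ × ℝ → ℂ} (hF : ∀ j, Continuous (F j))
    {K : ℝ} (hK : ∀ j, ∀ x ∈ cell, x.2 ∈ Ioo (0 : ℝ) 1 → ‖F j x‖ ≤ K)
    (hlim : ∀ x ∈ cell, x.2 ∈ Ioo (0 : ℝ) 1 → Tendsto (fun j => F j x) atTop (𝓝 (G x)))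
    (g : L2Cell) :
    Tendsto (fun j => ∫ x in cell, F j x * g x) atTop (𝓝 (∫ x in cell, G x * g x)) := by
  refine tendsto_integral_of_dominated_convergence (fun x => K * ‖g x‖) ?_ ?_ ?_ ?_
  · exact fun j => (integrable_mul_cell (hF j) g).aestronglyMeasurable
  · exact (L2Cell.integrable g).norm.const_mul K
  · intro j
    filter_upwards [ae_cell_snd_mem] with x hx
    rw [norm_mul]
    exact mul_le_mul_of_nonneg_right (hK j x hx.1 hx.2) (norm_nonneg _)
  · filter_upwards [ae_cell_snd_mem] with x hx
    exact (hlim x hx.1 hx.2).mul_const _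

theorem fderiv_tensor_apply {E c : ℝ → ℂ} (hE : ContDiff ℝ ∞ E) (hc : ContDiff ℝ ∞ c) (x e : ℝ × ℝ) :
    fderiv ℝ (fun x : ℝ × ℝ => E x.1 * c x.2) x e
      = e.1 * (deriv E x.1 * c x.2) + e.2 * (E x.1 * deriv c x.2) := by
  have h1 : HasFDerivAt (fun x : ℝ × ℝ => E x.1) _ x :=
    ((hE.differentiable (by simp) x.1).hasDerivAt.hasFDerivAt).comp x hasFDerivAt_fst
  have h2 : HasFDerivAt (fun x : ℝ × ℝ => c x.2) _ x :=
    ((hc.differentiable (by simp) x.2).hasDerivAt.hasFDerivAt).comp x hasFDerivAt_snd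
  have h3 : HasFDerivAt (fun x : ℝ × ℝ => E x.1 * c x.2) _ x := h1.mul h2
  rw [h3.fderiv]
  simp
  ring

theorem contDiff_tensor {E c : ℝ → ℂ} (hE : ContDiff ℝ ∞ E) (hc : ContDiff ℝ ∞ c) :
    ContDiff ℝ ∞ (fun x : ℝ × ℝ => E x.1 * c x.2) :=
  (hE.comp contDiff_fst).mul (hc.comp contDiff_snd)

theorem contDiff_wallCutoff_mul {c : ℝ → ℂ} (hc : ContDiff ℝ ∞ c) (j : ℕ) :
    ContDiff ℝ ∞ (fun t => (wallCutoff j t : ℂ) * c t) :=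
  (Complex.ofRealCLM.contDiff.comp (contDiff_wallCutoff j)).mul hc

theorem integral_by_parts_wallCutoff {e : ℝ × ℝ} {g h : L2Cell}
    (H : HasWeakPartial guideInterior e (qpExt 1 g) (qpExt 1 h)) {E c : ℝ → ℂ}
    (hE : ContDiff ℝ ∞ E) (hper : Function.Periodic E 1) (hc : ContDiff ℝ ∞ c) (j : ℕ) :
    ∫ x in cell, (e.1 * (deriv E x.1 * ((wallCutoff j x.2 : ℂ) * c x.2)) +
        e.2 * (E x.1 * deriv (fun t => (wallCutoff j t : ℂ) * c t) x.2)) * g x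
      = -∫ x in cell, (E x.1 * ((wallCutoff j x.2 : ℂ) * c x.2)) * h x := by
  have key := integral_by_parts_of_compact H
    (contDiff_tensor hE (contDiff_wallCutoff_mul hc j))
    (fun x => by simp only [hper x.1]) (δ := 1 / ((j : ℝ) + 1)) (by positivity)
    (fun x hx => by simp [wallCutoff_eq_zero j hx])
  simpa only [fderiv_tensor_apply hE (contDiff_wallCutoff_mul hc j)] using key

theorem tendsto_integral_wallCutoff {E c : ℝ → ℂ} (hE : Continuous E) (hc : Continuous c)
    (g : L2Cell) :
    Tendsto (fun j => ∫ x in cell, (E x.1 * ((wallCutoff j x.2 : ℂ) * c x.2)) * g x) atTop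
      (𝓝 (∫ x in cell, (E x.1 * c x.2) * g x)) := by
  obtain ⟨K, hK⟩ := exists_bound_on_cell (φ := fun x => E x.1 * c x.2) (by fun_prop)
  refine tendsto_integral_cell (K := K) (fun j => ?_) (fun j x hx _ => ?_) (fun x _ hx => ?_) g
  · have := (contDiff_wallCutoff j).continuous
    fun_prop
  · calc ‖E x.1 * ((wallCutoff j x.2 : ℂ) * c x.2)‖
        = |wallCutoff j x.2| * ‖E x.1 * c x.2‖ := by
          simp only [norm_mul, Complex.norm_real, Real.norm_eq_abs]; ring
      _ ≤ 1 * K := mul_le_mul (abs_wallCutoff_le j _) (hK x hx) (norm_nonneg _) zero_le_one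
      _ = K := one_mul K
  · have h1 := (Complex.continuous_ofReal.tendsto _).comp (tendsto_wallCutoff hx)
    have h2 := (h1.mul_const (c x.2)).const_mul (E x.1)
    simpa using h2

/-- Integration by parts along the guide. -/
theorem integral_by_parts_fst {g h : L2Cell}
    (H : HasWeakPartial guideInterior (1, 0) (qpExt 1 g) (qpExt 1 h)) {E c : ℝ → ℂ}
    (hE : ContDiff ℝ ∞ E) (hper : Function.Periodic E 1) (hc : ContDiff ℝ ∞ c) :
    ∫ x in cell, (deriv E x.1 * c x.2) * g x = -∫ x in cell, (E x.1 * c x.2) * h x := by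
  have h1 := integral_by_parts_wallCutoff H hE hper hc
  simp only [Complex.ofReal_one, Complex.ofReal_zero, one_mul, zero_mul, add_zero] at h1
  -- The cutoff depends on `x₂` only, so `∂₁` does not act on it and both sides converge without any
  -- condition on the walls.
  refine tendsto_nhds_unique
    (tendsto_integral_wallCutoff (hE.continuous_deriv (by simp)) hc.continuous g) ?_
  simp only [h1]
  exact (tendsto_integral_wallCutoff hE.continuous hc.continuous h).neg

/-- Integration by parts across the guide, against functions that vanish on the walls. -/
theorem integral_by_parts_snd {g h : L2Cell}
    (H : HasWeakPartial guideInterior (0, 1) (qpExt 1 g) (qpExt 1 h)) {E c : ℝ → ℂ}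
    (hE : ContDiff ℝ ∞ E) (hper : Function.Periodic E 1) (hc : ContDiff ℝ ∞ c) {C : ℝ}
    (hC : ∀ t ∈ Ioo (0 : ℝ) 1, ‖c t‖ ≤ C * (t * (1 - t))) :
    ∫ x in cell, (E x.1 * deriv c x.2) * g x = -∫ x in cell, (E x.1 * c x.2) * h x := by
  have h1 := integral_by_parts_wallCutoff H hE hper hc
  simp only [Complex.ofReal_one, Complex.ofReal_zero, one_mul, zero_mul, zero_add] at h1
  have hdc : Continuous (deriv c) := hc.continuous_deriv (by simp)
  have hd : ∀ j t, deriv (fun t => (wallCutoff j t : ℂ) * c t) t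
      = (deriv (wallCutoff j) t : ℝ) * c t + (wallCutoff j t : ℂ) * deriv c t := by
    intro j t
    have d1 : HasDerivAt (fun t => (wallCutoff j t : ℂ)) _ t :=
      (((contDiff_wallCutoff j).differentiable (by simp) t).hasDerivAt).ofReal_comp
    have d3 : HasDerivAt (fun t => (wallCutoff j t : ℂ) * c t) _ t :=
      d1.mul ((hc.differentiable (by simp) t).hasDerivAt)
    rw [d3.deriv]
  obtain ⟨M, hM⟩ := exists_bound_deriv_wallCutoff
  obtain ⟨K, hK⟩ := exists_bound_on_cell (φ := fun x => E x.1 * deriv c x.2)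
    (by have := hE.continuous; fun_prop)
  obtain ⟨K', hK'⟩ := exists_bound_on_cell (φ := fun x => E x.1)
    (by have := hE.continuous; fun_prop)
  have hC0 : 0 ≤ C := by
    have := (norm_nonneg _).trans (hC (1 / 2) (by norm_num))
    linarith
  -- In the dominating constant, `K' * (M * C)` is for the derivative falling on the cutoff and `K`
  -- for the derivative falling on `c`.
  refine tendsto_nhds_unique (f := fun j => ∫ x in cell,
    (E x.1 * deriv (fun t => (wallCutoff j t : ℂ) * c t) x.2) * g x)
    (tendsto_integral_cell (K := K' * (M * C) + K) (fun j => ?_) (fun j x hx hx2 => ?_)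
      (fun x _ hx => ?_) g) ?_
  · have := (contDiff_wallCutoff_mul hc j).continuous_deriv (by simp)
    have := hE.continuous
    fun_prop
  · rw [hd, mul_add]
    refine (norm_add_le _ _).trans (add_le_add ?_ ?_)
    · rw [norm_mul, norm_mul, Complex.norm_real, Real.norm_eq_abs]
      refine mul_le_mul (hK' x hx) ?_ (by positivity) ((norm_nonneg _).trans (hK' x hx))
      calc |deriv (wallCutoff j) x.2| * ‖c x.2‖
          ≤ |deriv (wallCutoff j) x.2| * (C * (x.2 * (1 - x.2))) :=
            mul_le_mul_of_nonneg_left (hC _ hx2) (abs_nonneg _)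
        _ = |deriv (wallCutoff j) x.2| * (x.2 * (1 - x.2)) * C := by ring
        _ ≤ M * C := mul_le_mul_of_nonneg_right (hM j _ hx2) hC0
    · calc ‖E x.1 * ((wallCutoff j x.2 : ℂ) * deriv c x.2)‖
          = |wallCutoff j x.2| * ‖E x.1 * deriv c x.2‖ := by
            simp only [norm_mul, Complex.norm_real, Real.norm_eq_abs]; ring
        _ ≤ 1 * K := mul_le_mul (abs_wallCutoff_le j _) (hK x hx) (norm_nonneg _) zero_le_one
        _ = K := one_mul K
  · simp only [hd]
    have t1 := (Complex.continuous_ofReal.tendsto _).comp (tendsto_wallCutoff hx)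
    have t2 := (Complex.continuous_ofReal.tendsto _).comp (tendsto_deriv_wallCutoff hx)
    have t3 := ((t2.mul_const (c x.2)).add (t1.mul_const (deriv c x.2))).const_mul (E x.1)
    simpa using t3
  · simp only [h1]
    exact (tendsto_integral_wallCutoff hE.continuous hc.continuous h).neg

/-! ### Orthonormal Fourier modes on the cell -/

/-- The exponentials `exp (2 π i n t)`. -/
def expMode (n : ℤ) (t : ℝ) : ℂ := Complex.exp (2 * Real.pi * Complex.I * n * t)

theorem contDiff_expMode (n : ℤ) : ContDiff ℝ ∞ (expMode n) := by
  unfold expMode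
  exact (contDiff_const.mul Complex.ofRealCLM.contDiff).cexp

theorem periodic_expMode (n : ℤ) : Function.Periodic (expMode n) 1 := by
  intro t
  rw [expMode, expMode, Complex.exp_eq_exp_iff_exists_int]
  exact ⟨n, by push_cast; ring⟩

theorem deriv_expMode (n : ℤ) (t : ℝ) :
    deriv (expMode n) t = 2 * Real.pi * Complex.I * n * expMode n t := by
  have h1 : HasDerivAt (fun t : ℝ => 2 * Real.pi * Complex.I * n * (t : ℂ))
      (2 * Real.pi * Complex.I * n) t := by
    simpa using (Complex.ofRealCLM.hasDerivAt (x := t)).const_mul (2 * Real.pi * Complex.I * n)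
  have h2 : HasDerivAt (expMode n) _ t := h1.cexp
  rw [h2.deriv, expMode]
  ring

theorem star_expMode (n : ℤ) (t : ℝ) : starRingEnd ℂ (expMode n t) = expMode (-n) t := by
  rw [expMode, expMode, ← Complex.exp_conj]
  congr 1
  rw [map_mul, map_mul, map_mul, map_mul, Complex.conj_I, map_ofNat, Complex.conj_ofReal,
    Complex.conj_ofReal, map_intCast]
  push_cast
  ring

theorem expMode_mul (n m : ℤ) (t : ℝ) : expMode n t * expMode m t = expMode (n + m) t := by
  rw [expMode, expMode, expMode, ← Complex.exp_add]
  congr 1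
  push_cast
  ring

theorem integral_expMode (n : ℤ) :
    ∫ t in Ioc (-1 / 2 : ℝ) (1 / 2), expMode n t = if n = 0 then 1 else 0 := by
  rw [← intervalIntegral.integral_of_le (by norm_num)]
  split_ifs with h
  · simp [h, expMode]
    norm_num
  · have hc : 2 * Real.pi * Complex.I * n ≠ 0 := by
      simp [h, Real.pi_ne_zero]
    simp only [expMode]
    rw [integral_exp_mul_complex hc, div_eq_zero_iff]
    left
    rw [sub_eq_zero, Complex.exp_eq_exp_iff_exists_int]
    exact ⟨n, by push_cast; ring⟩

theorem integral_cos_int (k : ℤ) :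
    ∫ t in Icc (0 : ℝ) 1, Real.cos (Real.pi * k * t) = if k = 0 then 1 else 0 := by
  rw [integral_Icc_eq_integral_Ioc, ← intervalIntegral.integral_of_le zero_le_one]
  split_ifs with h
  · simp [h]
  · have hc : Real.pi * k ≠ 0 := mul_ne_zero Real.pi_ne_zero (by exact_mod_cast h)
    rw [intervalIntegral.integral_comp_mul_left (fun t => Real.cos t) hc, integral_cos, mul_one,
      mul_zero, Real.sin_zero, mul_comm Real.pi, Real.sin_int_mul_pi]
    simp

theorem integrableOn_Icc_cos (c : ℝ) : IntegrableOn (fun t => Real.cos (c * t)) (Icc 0 1) :=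
  (by fun_prop : Continuous fun t => Real.cos (c * t)).integrableOn_Icc

theorem integral_cos_mul_cos (m k : ℕ) :
    ∫ t in Icc (0 : ℝ) 1, Real.cos (Real.pi * m * t) * Real.cos (Real.pi * k * t)
      = if m = k then (if m = 0 then 1 else 1 / 2) else 0 := by
  have e : ∀ t : ℝ, Real.cos (Real.pi * m * t) * Real.cos (Real.pi * k * t)
      = 1 / 2 * (Real.cos (Real.pi * ((m - k : ℤ) : ℝ) * t)
        + Real.cos (Real.pi * ((m + k : ℤ) : ℝ) * t)) := by
    intro t
    push_cast
    rw [show Real.pi * ((m : ℝ) - k) * t = Real.pi * m * t - Real.pi * k * t by ring,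
      show Real.pi * ((m : ℝ) + k) * t = Real.pi * m * t + Real.pi * k * t by ring,
      Real.cos_add, Real.cos_sub]
    ring
  simp only [e]
  rw [integral_const_mul, integral_add (integrableOn_Icc_cos _) (integrableOn_Icc_cos _),
    integral_cos_int, integral_cos_int]
  by_cases h : m = k
  · subst h
    by_cases h0 : m = 0
    · simp [h0]; norm_num
    · have : (m : ℤ) + m ≠ 0 := by omega
      simp [h0]
  · have h1 : (m : ℤ) - k ≠ 0 := by omega
    have h2 : (m : ℤ) + k ≠ 0 := by omega
    rw [if_neg h1, if_neg h2, if_neg h]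
    norm_num

theorem integral_sin_mul_sin (m k : ℕ) (hm : m ≠ 0) :
    ∫ t in Icc (0 : ℝ) 1, Real.sin (Real.pi * m * t) * Real.sin (Real.pi * k * t)
      = if m = k then 1 / 2 else 0 := by
  have e : ∀ t : ℝ, Real.sin (Real.pi * m * t) * Real.sin (Real.pi * k * t)
      = 1 / 2 * (Real.cos (Real.pi * ((m - k : ℤ) : ℝ) * t)
        - Real.cos (Real.pi * ((m + k : ℤ) : ℝ) * t)) := by
    intro t
    push_cast
    rw [show Real.pi * ((m : ℝ) - k) * t = Real.pi * m * t - Real.pi * k * t by ring,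
      show Real.pi * ((m : ℝ) + k) * t = Real.pi * m * t + Real.pi * k * t by ring,
      Real.cos_add, Real.cos_sub]
    ring
  simp only [e]
  rw [integral_const_mul, integral_sub (integrableOn_Icc_cos _) (integrableOn_Icc_cos _),
    integral_cos_int, integral_cos_int]
  have h2 : (m : ℤ) + k ≠ 0 := by omega
  rw [if_neg h2]
  by_cases h : m = k
  · subst h
    simp
  · have h1 : (m : ℤ) - k ≠ 0 := by omega
    rw [if_neg h1, if_neg h]
    norm_num

/-- The normalized cosines on `[0, 1]`. -/
def cosMode (m : ℕ) (t : ℝ) : ℝ :=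
  (if m = 0 then 1 else Real.sqrt 2) * Real.cos (Real.pi * m * t)

/-- The normalized sines on `[0, 1]`. -/
def sinMode (m : ℕ) (t : ℝ) : ℝ := Real.sqrt 2 * Real.sin (Real.pi * m * t)

theorem contDiff_cosMode (m : ℕ) : ContDiff ℝ ∞ (cosMode m) := by
  unfold cosMode
  exact contDiff_const.mul (Real.contDiff_cos.comp (by fun_prop))

theorem contDiff_sinMode (m : ℕ) : ContDiff ℝ ∞ (sinMode m) := by
  unfold sinMode
  exact contDiff_const.mul (Real.contDiff_sin.comp (by fun_prop))

theorem deriv_sinMode {m : ℕ} (hm : m ≠ 0) (t : ℝ) :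
    deriv (sinMode m) t = Real.pi * m * cosMode m t := by
  have h1 : HasDerivAt (fun t : ℝ => Real.pi * m * t) (Real.pi * m) t := by
    simpa using (hasDerivAt_id t).const_mul (Real.pi * m)
  have h2 : HasDerivAt (sinMode m) _ t := h1.sin.const_mul (Real.sqrt 2)
  rw [h2.deriv, cosMode, if_neg hm]
  ring

/-- This is the linear vanishing on the walls that `integral_by_parts_snd` asks for. It follows from
`|sin x| ≤ |x|` at `0` and, after reflection, at `1`; the factor `2` appears because one of `t`, `1
- t` is at least `1 / 2`. -/
theorem abs_sinMode_le (m : ℕ) {t : ℝ} (ht : t ∈ Ioo (0 : ℝ) 1) :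
    |sinMode m t| ≤ Real.sqrt 2 * (2 * (Real.pi * m)) * (t * (1 - t)) := by
  have h1t : 0 < 1 - t := sub_pos.2 ht.2
  have a1 : |Real.sin (Real.pi * m * t)| ≤ Real.pi * m * t := by
    have := Real.abs_sin_le_abs (x := Real.pi * m * t)
    rwa [abs_of_nonneg (a := Real.pi * m * t)
      (mul_nonneg (mul_nonneg Real.pi_pos.le (Nat.cast_nonneg m)) ht.1.le)] at this
  have a2 : |Real.sin (Real.pi * m * t)| ≤ Real.pi * m * (1 - t) := by
    have := Real.abs_sin_le_abs (x := Real.pi * m * (1 - t))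
    rw [abs_of_nonneg (a := Real.pi * m * (1 - t))
      (mul_nonneg (mul_nonneg Real.pi_pos.le (Nat.cast_nonneg m)) h1t.le)] at this
    have e : |Real.sin (Real.pi * m * (1 - t))| = |Real.sin (Real.pi * m * t)| := by
      rw [show Real.pi * m * (1 - t) = m * Real.pi - Real.pi * m * t by ring,
        Real.sin_nat_mul_pi_sub, abs_neg, abs_mul, abs_pow, abs_neg, abs_one, one_pow, one_mul]
    rwa [e] at this
  have hp : 0 ≤ Real.pi * m := mul_nonneg Real.pi_pos.le (Nat.cast_nonneg m)
  have h : |Real.sin (Real.pi * m * t)| ≤ 2 * (Real.pi * m) * (t * (1 - t)) := by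
    rcases le_total t (1 / 2) with h | h
    · refine a1.trans ?_
      have : t ≤ 2 * (t * (1 - t)) := by nlinarith [ht.1]
      nlinarith
    · refine a2.trans ?_
      have : 1 - t ≤ 2 * (t * (1 - t)) := by nlinarith
      nlinarith
  rw [sinMode, abs_mul, abs_of_nonneg (Real.sqrt_nonneg 2), mul_assoc (Real.sqrt 2)]
  exact mul_le_mul_of_nonneg_left h (Real.sqrt_nonneg 2)

theorem integral_cosMode_mul (m k : ℕ) :
    ∫ t in Icc (0 : ℝ) 1, cosMode m t * cosMode k t = if m = k then 1 else 0 := by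
  simp only [cosMode, mul_mul_mul_comm _ (Real.cos _)]
  rw [integral_const_mul, integral_cos_mul_cos]
  by_cases h : m = k
  · subst h
    by_cases h0 : m = 0 <;> simp [h0]
  · simp [h]

theorem integral_sinMode_mul (m k : ℕ) (hm : m ≠ 0) :
    ∫ t in Icc (0 : ℝ) 1, sinMode m t * sinMode k t = if m = k then 1 else 0 := by
  simp only [sinMode, mul_mul_mul_comm _ (Real.sin _)]
  rw [integral_const_mul, integral_sin_mul_sin m k hm]
  by_cases h : m = k <;> simp [h]

/-- The class in `L²(Ω₀)` of the product of an exponential in `x₁` and a function of `x₂`. -/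
def tensorMode (n : ℤ) (c : ℝ → ℝ) (hc : ContDiff ℝ ∞ c) : L2Cell :=
  ofCont (fun x => expMode n x.1 * (c x.2 : ℂ))
    (by have := (contDiff_expMode n).continuous; have := hc.continuous; fun_prop)

theorem inner_tensorMode (n : ℤ) {c : ℝ → ℝ} (hc : ContDiff ℝ ∞ c) (g : L2Cell) :
    inner ℂ (tensorMode n c hc) g = ∫ x in cell, (expMode (-n) x.1 * (c x.2 : ℂ)) * g x := by
  rw [tensorMode, inner_ofCont]
  simp only [map_mul, star_expMode, Complex.conj_ofReal]

theorem inner_tensorMode_tensorMode (n k : ℤ) {c d : ℝ → ℝ} (hc : ContDiff ℝ ∞ c)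
    (hd : ContDiff ℝ ∞ d) :
    inner ℂ (tensorMode n c hc) (tensorMode k d hd)
      = (if n = k then 1 else 0) * ((∫ t in Icc (0 : ℝ) 1, c t * d t : ℝ) : ℂ) := by
  rw [inner_tensorMode]
  have e : ∫ x in cell, (expMode (-n) x.1 * (c x.2 : ℂ)) * tensorMode k d hd x
      = ∫ x in cell, expMode (-n + k) x.1 * ((c x.2 * d x.2 : ℝ) : ℂ) := by
    refine integral_congr_ae ?_
    filter_upwards [coeFn_ofCont (φ := fun x => expMode k x.1 * (d x.2 : ℂ))
      (by have := (contDiff_expMode k).continuous; have := hd.continuous; fun_prop)] with x hx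
    rw [tensorMode, hx, ← expMode_mul]
    push_cast
    ring
  rw [e, cell, Measure.volume_eq_prod,
    setIntegral_prod_mul (expMode (-n + k)) (fun t => ((c t * d t : ℝ) : ℂ)),
    integral_expMode, integral_complex_ofReal]
  congr 1
  by_cases h : n = k
  · simp [h]
  · rw [if_neg h, if_neg (by omega)]

/-- The Fourier modes that are periodic in `x₁` and satisfy the Neumann condition on the walls. -/
def neumannMode (i : ℤ × ℕ) : L2Cell := tensorMode i.1 (cosMode i.2) (contDiff_cosMode i.2)

/-- The Fourier modes that are periodic in `x₁` and vanish on the walls. -/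
def dirichletMode (i : ℤ × ℕ) : L2Cell := tensorMode i.1 (sinMode i.2) (contDiff_sinMode i.2)

theorem orthonormal_neumannMode : Orthonormal ℂ neumannMode := by
  rw [orthonormal_iff_ite]
  intro i j
  rw [neumannMode, neumannMode, inner_tensorMode_tensorMode, integral_cosMode_mul]
  by_cases h1 : i.1 = j.1 <;> by_cases h2 : i.2 = j.2 <;> simp [Prod.ext_iff, h1, h2]

theorem orthonormal_dirichletMode :
    Orthonormal ℂ fun i : {i : ℤ × ℕ // i.2 ≠ 0} => dirichletMode i := by
  rw [orthonormal_iff_ite]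
  intro i j
  rw [dirichletMode, dirichletMode, inner_tensorMode_tensorMode, integral_sinMode_mul _ _ i.2]
  by_cases h1 : i.1.1 = j.1.1 <;> by_cases h2 : i.1.2 = j.1.2 <;>
    simp [Subtype.ext_iff, Prod.ext_iff, h1, h2]

/-! ### Completeness of the modes by Stone-Weierstrass -/

/-- The compact cylinder obtained from the cell by identifying its two vertical sides. -/
abbrev Cylinder : Type := UnitAddCircle × Icc (0 : ℝ) 1

/-- The map of the cell onto the cylinder. -/
def toCylinder (x : ℝ × ℝ) : Cylinder := (x.1, projIcc 0 1 zero_le_one x.2)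

theorem continuous_toCylinder : Continuous toCylinder := by
  unfold toCylinder
  exact ((AddCircle.continuous_mk' 1).comp continuous_fst).prodMk
    (continuous_projIcc.comp continuous_snd)

/-- The inverse of `toCylinder` on the cell. -/
def ofCylinder (y : Cylinder) : ℝ × ℝ := ((AddCircle.equivIoc 1 (-1 / 2) y.1 : ℝ), (y.2 : ℝ))

theorem measurable_ofCylinder : Measurable ofCylinder := by
  refine Measurable.prodMk ?_ (measurable_subtype_coe.comp measurable_snd)
  exact measurable_subtype_coe.comp
    ((AddCircle.measurableEquivIoc 1 (-1 / 2)).measurable.comp measurable_fst)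

theorem ofCylinder_toCylinder {x : ℝ × ℝ} (hx : x ∈ cell) : ofCylinder (toCylinder x) = x := by
  have h1 : x.1 ∈ Ioc (-1 / 2 : ℝ) (-1 / 2 + 1) := ⟨hx.1.1, by linarith [hx.1.2]⟩
  have h2 : AddCircle.equivIoc 1 (-1 / 2) (x.1 : UnitAddCircle) = ⟨x.1, h1⟩ :=
    (AddCircle.equivIoc 1 (-1 / 2)).apply_symm_apply ⟨x.1, h1⟩
  ext
  · simp only [ofCylinder, toCylinder, h2]
  · simp only [ofCylinder, toCylinder, projIcc_of_mem zero_le_one hx.2]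

/-- The trigonometric monomials on the cylinder. -/
def cylinderMode (i : ℤ × ℕ) : C(Cylinder, ℂ) where
  toFun y := fourier i.1 y.1 * (Real.cos (Real.pi * i.2 * y.2) : ℂ)
  continuous_toFun := by fun_prop

theorem cylinderMode_toCylinder (i : ℤ × ℕ) {x : ℝ × ℝ} (hx : x ∈ cell) :
    cylinderMode i (toCylinder x) = expMode i.1 x.1 * (Real.cos (Real.pi * i.2 * x.2) : ℂ) := by
  simp only [cylinderMode, toCylinder, ContinuousMap.coe_mk, projIcc_of_mem zero_le_one hx.2,
    fourier_coe_apply, expMode]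
  simp

/-- The product-to-sum formula makes the linear span an algebra. The difference `max - min` is `|i.2
- j.2|` in `ℕ`, which suffices because cosine is even. -/
theorem cylinderMode_mul (i j : ℤ × ℕ) : cylinderMode i * cylinderMode j
    = (1 / 2 : ℂ) • (cylinderMode (i.1 + j.1, i.2 + j.2)
      + cylinderMode (i.1 + j.1, max i.2 j.2 - min i.2 j.2)) := by
  ext y
  have hc : Real.cos (Real.pi * ((max i.2 j.2 - min i.2 j.2 : ℕ) : ℝ) * y.2)
      = Real.cos (Real.pi * i.2 * y.2 - Real.pi * j.2 * y.2) := by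
    rcases le_total i.2 j.2 with h | h
    · rw [max_eq_right h, min_eq_left h, Nat.cast_sub h, ← Real.cos_neg]
      congr 1
      ring
    · rw [max_eq_left h, min_eq_right h, Nat.cast_sub h]
      congr 1
      ring
  have hs : Real.cos (Real.pi * ((i.2 + j.2 : ℕ) : ℝ) * y.2)
      = Real.cos (Real.pi * i.2 * y.2 + Real.pi * j.2 * y.2) := by
    congr 1
    push_cast
    ring
  simp only [cylinderMode, ContinuousMap.mul_apply, ContinuousMap.smul_apply,
    ContinuousMap.add_apply, ContinuousMap.coe_mk, hc, hs, Real.cos_add, Real.cos_sub, fourier_add,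
    smul_eq_mul]
  push_cast
  ring

theorem mul_mem_span_cylinderMode {f g : C(Cylinder, ℂ)}
    (hf : f ∈ Submodule.span ℂ (range cylinderMode))
    (hg : g ∈ Submodule.span ℂ (range cylinderMode)) :
    f * g ∈ Submodule.span ℂ (range cylinderMode) := by
  have h := Submodule.mul_mem_mul hf hg
  rw [Submodule.span_mul_span] at h
  refine Submodule.span_le.2 ?_ h
  rintro _ ⟨_, ⟨i, rfl⟩, _, ⟨j, rfl⟩, rfl⟩
  simp only [cylinderMode_mul]
  exact Submodule.smul_mem _ _ (Submodule.add_mem _ (Submodule.subset_span ⟨_, rfl⟩)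
    (Submodule.subset_span ⟨_, rfl⟩))

theorem star_cylinderMode (i : ℤ × ℕ) : star (cylinderMode i) = cylinderMode (-i.1, i.2) := by
  ext y
  simp only [cylinderMode, ContinuousMap.star_apply, ContinuousMap.coe_mk, fourier_neg,
    RCLike.star_def, map_mul, Complex.conj_ofReal]

/-- The star algebra of trigonometric polynomials on the cylinder. -/
def cylinderAlgebra : StarSubalgebra ℂ C(Cylinder, ℂ) where
  carrier := Submodule.span ℂ (range cylinderMode)
  mul_mem' := mul_mem_span_cylinderMode
  add_mem' := Submodule.add_mem _
  algebraMap_mem' c := by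
    have h : algebraMap ℂ C(Cylinder, ℂ) c = c • cylinderMode (0, 0) := by
      ext y
      simp [cylinderMode]
    rw [h]
    exact Submodule.smul_mem _ _ (Submodule.subset_span ⟨_, rfl⟩)
  star_mem' {f} hf := by
    refine Submodule.span_induction ?_ ?_ ?_ ?_ hf
    · rintro _ ⟨i, rfl⟩
      rw [star_cylinderMode]
      exact Submodule.subset_span ⟨_, rfl⟩
    · rw [star_zero]
      exact Submodule.zero_mem _
    · intro f g _ _ h1 h2
      rw [star_add]
      exact Submodule.add_mem _ h1 h2
    · intro c f _ h
      rw [star_smul]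
      exact Submodule.smul_mem _ _ h

/-- `cos (π t)` is injective on `[0, 1]`, and the first exponential is injective on the circle. -/
theorem cylinderAlgebra_separatesPoints : cylinderAlgebra.SeparatesPoints := by
  have hmem : ∀ i, cylinderMode i ∈ (cylinderAlgebra : Set C(Cylinder, ℂ)) := fun i =>
    Submodule.subset_span (s := range cylinderMode) ⟨i, rfl⟩
  intro x y hxy
  by_cases h1 : x.1 = y.1
  · have h2 : x.2 ≠ y.2 := fun h2 => hxy (Prod.ext h1 h2)
    refine ⟨_, ⟨cylinderMode (0, 1), hmem _, rfl⟩, fun h => h2 (Subtype.ext ?_)⟩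
    have h3 : Real.cos (Real.pi * x.2) = Real.cos (Real.pi * y.2) := by
      simp only [cylinderMode, ContinuousMap.coe_mk, fourier_zero, Nat.cast_one, one_mul,
        mul_one] at h
      exact_mod_cast h
    have h4 := Real.injOn_cos (x₁ := Real.pi * x.2) (x₂ := Real.pi * y.2)
      ⟨mul_nonneg Real.pi_pos.le x.2.2.1, mul_le_of_le_one_right Real.pi_pos.le x.2.2.2⟩
      ⟨mul_nonneg Real.pi_pos.le y.2.2.1, mul_le_of_le_one_right Real.pi_pos.le y.2.2.2⟩ h3
    exact mul_left_cancel₀ Real.pi_ne_zero h4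
  · refine ⟨_, ⟨cylinderMode (1, 0), hmem _, rfl⟩, fun h => h1 ?_⟩
    simp only [cylinderMode, ContinuousMap.coe_mk, Nat.cast_zero, mul_zero, zero_mul,
      Real.cos_zero, Complex.ofReal_one, mul_one, fourier_one] at h
    exact AddCircle.injective_toCircle one_ne_zero (Subtype.ext h)

theorem span_cylinderMode_topologicalClosure :
    (Submodule.span ℂ (range cylinderMode)).topologicalClosure = ⊤ := by
  have h := ContinuousMap.starSubalgebra_topologicalClosure_eq_top_of_separatesPoints _
    cylinderAlgebra_separatesPoints
  rw [eq_top_iff]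
  intro f _
  have hf : f ∈ cylinderAlgebra.topologicalClosure := by rw [h]; trivial
  exact hf

/-- The exponentials do not separate `x₁ = ±1/2`, so `f` is carried to the cylinder with the image
measure `ν`. There the modes span a dense subspace of the continuous functions, and these are dense
in `L²(ν)`. -/
theorem eq_zero_of_integral_modes {f : L2Cell}
    (hf : ∀ i : ℤ × ℕ, ∫ x in cell, (expMode i.1 x.1 * (Real.cos (Real.pi * i.2 * x.2) : ℂ)) * f x
      = 0) : f = 0 := by
  set μ : Measure (ℝ × ℝ) := volume.restrict cell with hμ
  have hΦ : Measurable toCylinder := continuous_toCylinder.measurable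
  set ν : Measure Cylinder := μ.map toCylinder with hν
  have : IsFiniteMeasure ν := Measure.isFiniteMeasure_map μ toCylinder
  have hcomp : (fun y => f (ofCylinder y)) ∘ toCylinder =ᵐ[μ] f := by
    filter_upwards [ae_restrict_mem measurableSet_cell] with x hx
    simp only [Function.comp, ofCylinder_toCylinder hx]
  have hsm : StronglyMeasurable fun y => f (ofCylinder y) :=
    (Lp.stronglyMeasurable f).comp_measurable measurable_ofCylinder
  have hmem : MemLp (fun y => f (ofCylinder y)) 2 ν := by
    rw [hν, memLp_map_measure_iff hsm.aestronglyMeasurable hΦ.aemeasurable]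
    exact (memLp_congr_ae hcomp).2 (Lp.memLp f)
  set G : Lp ℂ 2 ν := hmem.toLp _ with hG
  have hmode : ∀ i, inner ℂ G (ContinuousMap.toLp 2 ν ℂ (cylinderMode i)) = 0 := by
    intro i
    rw [← inner_conj_symm, map_eq_zero, L2.inner_def]
    have e1 : ∫ y, inner ℂ (ContinuousMap.toLp 2 ν ℂ (cylinderMode i) y) (G y) ∂ν
        = ∫ y, cylinderMode (-i.1, i.2) y * f (ofCylinder y) ∂ν := by
      refine integral_congr_ae ?_
      filter_upwards [ContinuousMap.coeFn_toLp (p := 2) (𝕜 := ℂ) ν (cylinderMode i),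
        hmem.coeFn_toLp] with y h1 h2
      rw [h1, h2, RCLike.inner_apply, ← star_cylinderMode, mul_comm]
      rfl
    rw [e1, hν, integral_map hΦ.aemeasurable]
    · rw [← hf (-i.1, i.2)]
      refine setIntegral_congr_fun measurableSet_cell fun x hx => ?_
      simp only [cylinderMode_toCylinder _ hx, ofCylinder_toCylinder hx]
    · exact (((cylinderMode (-i.1, i.2)).continuous.stronglyMeasurable).mul
        hsm).aestronglyMeasurable
  have hcl : ∀ h : C(Cylinder, ℂ), inner ℂ G (ContinuousMap.toLp 2 ν ℂ h) = 0 := by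
    intro h
    set S : Submodule ℂ C(Cylinder, ℂ) :=
      ((innerSL ℂ G).comp (ContinuousMap.toLp 2 ν ℂ)).ker with hS
    have hSc : IsClosed (S : Set C(Cylinder, ℂ)) := ContinuousLinearMap.isClosed_ker _
    have hle : (Submodule.span ℂ (range cylinderMode)).topologicalClosure ≤ S := by
      refine Submodule.topologicalClosure_minimal _ (Submodule.span_le.2 ?_) hSc
      rintro _ ⟨i, rfl⟩
      exact hmode i
    rw [span_cylinderMode_topologicalClosure] at hle
    exact hle (x := h) trivial
  have hG0 : G = 0 := by
    have hd : DenseRange (ContinuousMap.toLp (E := ℂ) 2 ν ℂ) :=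
      ContinuousMap.toLp_denseRange ℂ ν ℂ (by norm_num)
    have h2 : ∀ g : Lp ℂ 2 ν, inner ℂ G g = 0 := fun g =>
      hd.induction_on (p := fun g => inner ℂ G g = 0) g
        (isClosed_eq (by fun_prop) continuous_const) hcl
    exact inner_self_eq_zero.1 (h2 G)
  have hae : (fun y => f (ofCylinder y)) =ᵐ[ν] 0 := by
    have h1 := hmem.coeFn_toLp
    rw [← hG, hG0] at h1
    exact h1.symm.trans (Lp.coeFn_zero ℂ 2 ν)
  rw [Lp.eq_zero_iff_ae_eq_zero]
  exact hcomp.symm.trans (ae_of_ae_map hΦ.aemeasurable hae)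

theorem span_neumannMode_orthogonal : (Submodule.span ℂ (range neumannMode))ᗮ = ⊥ := by
  rw [Submodule.eq_bot_iff]
  intro f hf
  refine eq_zero_of_integral_modes fun i => ?_
  have h := Submodule.inner_right_of_mem_orthogonal
    (Submodule.subset_span (mem_range_self (-i.1, i.2))) hf
  rw [neumannMode, inner_tensorMode] at h
  have hc : ((if i.2 = 0 then 1 else Real.sqrt 2 : ℝ) : ℂ) ≠ 0 := by
    split_ifs <;> simp
  refine (mul_eq_zero.1 ?_).resolve_left hc
  rw [← h, ← integral_const_mul]
  congr 1
  ext x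
  simp only [cosMode, neg_neg]
  push_cast
  ring

/-- The Neumann modes as a Hilbert basis of `L²(Ω₀)`. -/
def neumannBasis : HilbertBasis (ℤ × ℕ) ℂ L2Cell :=
  HilbertBasis.mkOfOrthogonalEqBot orthonormal_neumannMode span_neumannMode_orthogonal

theorem neumannBasis_apply (i : ℤ × ℕ) : neumannBasis i = neumannMode i :=
  congrFun (HilbertBasis.coe_mkOfOrthogonalEqBot orthonormal_neumannMode
    span_neumannMode_orthogonal) i

/-! ### Fourier coefficients of the gradient and Rellich compactness -/

theorem inner_neumannMode_d1 {g h : L2Cell}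
    (H : HasWeakPartial guideInterior (1, 0) (qpExt 1 g) (qpExt 1 h)) (i : ℤ × ℕ) :
    inner ℂ (neumannMode i) h = 2 * Real.pi * Complex.I * i.1 * inner ℂ (neumannMode i) g := by
  have key := integral_by_parts_fst H (contDiff_expMode (-i.1)) (periodic_expMode (-i.1))
    (c := fun t => (cosMode i.2 t : ℂ)) (Complex.ofRealCLM.contDiff.comp (contDiff_cosMode i.2))
  rw [neumannMode, inner_tensorMode, inner_tensorMode]
  rw [← neg_eq_iff_eq_neg] at key
  rw [← key, ← integral_const_mul, ← integral_neg]
  congr 1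
  ext x
  rw [deriv_expMode]
  push_cast
  ring

/-- The derivative in `x₂` is paired with sines, since `g` is arbitrary on the walls and the test
function has to vanish there. Differentiating the sine returns the cosine coefficient of `g`. -/
theorem inner_dirichletMode_d2 {g h : L2Cell}
    (H : HasWeakPartial guideInterior (0, 1) (qpExt 1 g) (qpExt 1 h)) {i : ℤ × ℕ} (hi : i.2 ≠ 0) :
    inner ℂ (dirichletMode i) h = -(Real.pi * i.2 * inner ℂ (neumannMode i) g) := by
  have key := integral_by_parts_snd H (contDiff_expMode (-i.1)) (periodic_expMode (-i.1))
    (c := fun t => (sinMode i.2 t : ℂ)) (Complex.ofRealCLM.contDiff.comp (contDiff_sinMode i.2))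
    (C := Real.sqrt 2 * (2 * (Real.pi * i.2)))
    (fun t ht => by rw [Complex.norm_real, Real.norm_eq_abs]; exact abs_sinMode_le _ ht)
  have hd : ∀ t : ℝ, deriv (fun t => (sinMode i.2 t : ℂ)) t
      = ((Real.pi * i.2 * cosMode i.2 t : ℝ) : ℂ) := by
    intro t
    rw [← deriv_sinMode hi]
    exact (((contDiff_sinMode i.2).differentiable (by simp) t).hasDerivAt.ofReal_comp).deriv
  rw [neumannMode, dirichletMode, inner_tensorMode, inner_tensorMode]
  rw [← neg_eq_iff_eq_neg] at key
  rw [← key, ← integral_const_mul]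
  congr 2
  ext x
  rw [hd]
  push_cast
  ring

/-- The space `H¹(Ω₀)` as a Hilbert space in its own right. -/
def SobolevCell : Type := H1Cell

instance : NormedAddCommGroup SobolevCell := inferInstanceAs (NormedAddCommGroup H1Cell)

instance : InnerProductSpace ℂ SobolevCell := inferInstanceAs (InnerProductSpace ℂ H1Cell)

instance : CompleteSpace SobolevCell := isClosed_H1Cell.completeSpace_coe

/-- The space `H¹_per(Ω₀)` as a Hilbert space in its own right. -/
def SobolevPer : Type := H1per

instance : NormedAddCommGroup SobolevPer := inferInstanceAs (NormedAddCommGroup H1per)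

instance : InnerProductSpace ℂ SobolevPer := inferInstanceAs (InnerProductSpace ℂ H1per)

instance : CompleteSpace SobolevPer := (isClosed_H1qp 1).completeSpace_coe

/-- An element of `H¹(Ω₀)` together with its weak derivatives. -/
def SobolevCell.toTriple : SobolevCell →ₗᵢ[ℂ] L2Triple where
  toFun u := Subtype.val (p := (· ∈ H1Cell)) u
  map_add' _ _ := rfl
  map_smul' _ _ := rfl
  norm_map' _ := rfl

/-- The inclusion of `H¹_per(Ω₀)` in `H¹(Ω₀)`. -/
def SobolevPer.incl : SobolevPer →ₗᵢ[ℂ] SobolevCell where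
  toFun u := Subtype.val (p := (· ∈ H1per)) u
  map_add' _ _ := rfl
  map_smul' _ _ := rfl
  norm_map' _ := rfl

/-- The components `u`, `∂₁u`, `∂₂u` of an element of `H¹_per(Ω₀)`. -/
def perComponent (i : Fin 3) : SobolevPer →L[ℂ] L2Cell :=
  (PiLp.proj (𝕜 := ℂ) 2 (fun _ : Fin 3 => L2Cell) i).comp
    (SobolevCell.toTriple.comp SobolevPer.incl).toContinuousLinearMap

theorem norm_sq_sobolevPer (u : SobolevPer) : ‖u‖ ^ 2
    = ‖perComponent 0 u‖ ^ 2 + ‖perComponent 1 u‖ ^ 2 + ‖perComponent 2 u‖ ^ 2 := by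
  have h : ‖u‖ = ‖SobolevCell.toTriple (SobolevPer.incl u)‖ := rfl
  rw [h, PiLp.norm_sq_eq_of_L2, Fin.sum_univ_three]
  rfl

theorem hasWeakPartial_perComponent_one (u : SobolevPer) :
    HasWeakPartial guideInterior (1, 0) (qpExt 1 (perComponent 0 u)) (qpExt 1 (perComponent 1 u)) :=
  (Subtype.prop (p := (· ∈ H1per)) u).1

theorem hasWeakPartial_perComponent_two (u : SobolevPer) :
    HasWeakPartial guideInterior (0, 1) (qpExt 1 (perComponent 0 u)) (qpExt 1 (perComponent 2 u)) :=
  (Subtype.prop (p := (· ∈ H1per)) u).2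

/-- The low Fourier modes. -/
def lowModes (N : ℕ) : Finset (ℤ × ℕ) := Finset.Icc (-(N : ℤ)) N ×ˢ Finset.range N

/-- The projection onto the low Fourier modes. -/
def lowPass (N : ℕ) : L2Cell →L[ℂ] L2Cell :=
  ∑ i ∈ lowModes N, (innerSL ℂ (neumannMode i)).smulRight (neumannMode i)

theorem isCompactOperator_lowPass (N : ℕ) : IsCompactOperator (lowPass N) := by
  unfold lowPass
  induction lowModes N using Finset.induction_on with
  | empty =>
    rw [Finset.sum_empty]
    exact isCompactOperator_zero
  | insert i s hi ih =>
    rw [Finset.sum_insert hi]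
    refine IsCompactOperator.add ?_ ih
    have h : IsCompactOperator (ContinuousLinearMap.toSpanSingleton ℂ (neumannMode i)) :=
      (isCompactOperator_id (E := ℂ)).clm_comp
        (ContinuousLinearMap.toSpanSingleton ℂ (neumannMode i))
    exact h.comp_clm (innerSL ℂ (neumannMode i))

theorem inner_neumannMode_lowPass (N : ℕ) (g : L2Cell) (i : ℤ × ℕ) :
    inner ℂ (neumannMode i) (g - lowPass N g)
      = if i ∈ lowModes N then 0 else inner ℂ (neumannMode i) g := by
  have h : inner ℂ (neumannMode i) (lowPass N g)
      = if i ∈ lowModes N then inner ℂ (neumannMode i) g else 0 := by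
    simp only [lowPass, sum_apply, inner_sum, ContinuousLinearMap.smulRight_apply,
      innerSL_apply_apply, inner_smul_right, orthonormal_iff_ite.1 orthonormal_neumannMode]
    simp
  rw [inner_sub_right, h]
  split_ifs <;> simp

/-- Outside `lowModes N` one of the frequencies `|n|`, `m` is at least `N`, so `N` times the
coefficient of `u` is dominated by that of `∂₁u` or `∂₂u`. Parseval on the left and Bessel for the
two orthonormal families on the right finish the estimate. -/
theorem norm_sq_sub_lowPass_le (N : ℕ) (u : SobolevPer) :
    (N : ℝ) ^ 2 * ‖perComponent 0 u - lowPass N (perComponent 0 u)‖ ^ 2 ≤ ‖u‖ ^ 2 := by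
  set r := perComponent 0 u - lowPass N (perComponent 0 u) with hr
  have hsum : HasSum (fun i => ‖inner ℂ (neumannMode i) r‖ ^ 2) (‖r‖ ^ 2) := by
    have h := neumannBasis.hasSum_inner_mul_inner r r
    have h2 : HasSum (fun i => ((‖inner ℂ (neumannMode i) r‖ ^ 2 : ℝ) : ℂ)) ((‖r‖ ^ 2 : ℝ) : ℂ) := by
      have e1 : ∀ i, inner ℂ r (neumannBasis i) * inner ℂ (neumannBasis i) r
          = ((‖inner ℂ (neumannMode i) r‖ ^ 2 : ℝ) : ℂ) := fun i => by
        rw [neumannBasis_apply, ← inner_conj_symm r (neumannMode i), Complex.conj_mul']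
        push_cast
        rfl
      have e2 : inner ℂ r r = ((‖r‖ ^ 2 : ℝ) : ℂ) := by
        rw [inner_self_eq_norm_sq_to_K]
        push_cast
        rfl
      simpa only [e1, e2] using h
    exact_mod_cast h2
  refine (hasSum_le_of_sum_le (hsum.mul_left ((N : ℝ) ^ 2)) (c := ‖u‖ ^ 2) fun T => ?_)
  have hterm : ∀ i : ℤ × ℕ, (N : ℝ) ^ 2 * ‖inner ℂ (neumannMode i) r‖ ^ 2
      ≤ ‖inner ℂ (neumannMode i) (perComponent 1 u)‖ ^ 2
        + if i.2 ≠ 0 then ‖inner ℂ (dirichletMode i) (perComponent 2 u)‖ ^ 2 else 0 := by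
    intro i
    rw [hr, inner_neumannMode_lowPass]
    have hnn : 0 ≤ if i.2 ≠ 0 then ‖inner ℂ (dirichletMode i) (perComponent 2 u)‖ ^ 2 else 0 := by
      split_ifs <;> positivity
    by_cases hi : i ∈ lowModes N
    · rw [if_pos hi, norm_zero, zero_pow two_ne_zero, mul_zero]
      exact add_nonneg (sq_nonneg _) hnn
    rw [if_neg hi]
    split_ifs with h2
    all_goals
      have hpi : (1 : ℝ) ≤ Real.pi := by linarith [Real.pi_gt_three]
      have e1 := inner_neumannMode_d1 (hasWeakPartial_perComponent_one u) i
      have n1 : ‖inner ℂ (neumannMode i) (perComponent 1 u)‖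
          = 2 * Real.pi * |(i.1 : ℝ)| * ‖inner ℂ (neumannMode i) (perComponent 0 u)‖ := by
        rw [e1]
        simp only [norm_mul, Complex.norm_ofNat, Complex.norm_real, Complex.norm_I,
          Complex.norm_intCast, Real.norm_eq_abs, abs_of_pos Real.pi_pos, mul_one]
      rw [lowModes, Finset.mem_product, Finset.mem_Icc, Finset.mem_range, not_and_or] at hi
      have hcase : (N : ℝ) ≤ |(i.1 : ℝ)| ∨ (N : ℝ) ≤ i.2 := by
        rcases hi with hi | hi
        · left
          have : (N : ℤ) ≤ |i.1| := by
            rcases abs_cases i.1 with ⟨h, _⟩ | ⟨h, _⟩ <;> omega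
          exact_mod_cast this
        · right
          exact_mod_cast not_lt.1 hi
    · have n2 : ‖inner ℂ (dirichletMode i) (perComponent 2 u)‖
          = Real.pi * i.2 * ‖inner ℂ (neumannMode i) (perComponent 0 u)‖ := by
        rw [inner_dirichletMode_d2 (hasWeakPartial_perComponent_two u) h2]
        simp only [norm_neg, norm_mul, Complex.norm_real, Complex.norm_natCast,
          Real.norm_eq_abs, abs_of_pos Real.pi_pos]
      rw [n1, n2]
      have hN0 : (0 : ℝ) ≤ N := Nat.cast_nonneg N
      have hi0 : (0 : ℝ) ≤ i.2 := Nat.cast_nonneg _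
      set c := ‖inner ℂ (neumannMode i) (perComponent 0 u)‖
      have hc : 0 ≤ c := norm_nonneg _
      rw [← mul_pow]
      rcases hcase with h | h
      · have : (N : ℝ) * c ≤ 2 * Real.pi * |(i.1 : ℝ)| * c :=
          mul_le_mul_of_nonneg_right (by nlinarith [abs_nonneg (i.1 : ℝ)]) hc
        have := pow_le_pow_left₀ (by positivity) this 2
        have := sq_nonneg (Real.pi * i.2 * c)
        linarith
      · have : (N : ℝ) * c ≤ Real.pi * i.2 * c :=
          mul_le_mul_of_nonneg_right (by nlinarith) hc
        have := pow_le_pow_left₀ (by positivity) this 2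
        have := sq_nonneg (2 * Real.pi * |(i.1 : ℝ)| * c)
        linarith
    · rw [n1, add_zero, ← mul_pow]
      have h : (N : ℝ) ≤ |(i.1 : ℝ)| := by
        rcases hcase with h | h
        · exact h
        · rw [not_not.1 h2] at h
          exact h.trans (by simp)
      refine pow_le_pow_left₀ (by positivity) ?_ 2
      refine mul_le_mul_of_nonneg_right ?_ (norm_nonneg _)
      nlinarith [abs_nonneg (i.1 : ℝ)]
  have hb1 : ∑ i ∈ T, ‖inner ℂ (neumannMode i) (perComponent 1 u)‖ ^ 2 ≤ ‖perComponent 1 u‖ ^ 2 :=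
    orthonormal_neumannMode.sum_inner_products_le _
  have hb2 : (∑ i ∈ T, if i.2 ≠ 0 then ‖inner ℂ (dirichletMode i) (perComponent 2 u)‖ ^ 2 else 0)
      ≤ ‖perComponent 2 u‖ ^ 2 := by
    rw [← Finset.sum_filter, ← Finset.sum_subtype_eq_sum_filter]
    exact orthonormal_dirichletMode.sum_inner_products_le _
  calc ∑ i ∈ T, (N : ℝ) ^ 2 * ‖inner ℂ (neumannMode i) r‖ ^ 2
      ≤ ∑ i ∈ T, (‖inner ℂ (neumannMode i) (perComponent 1 u)‖ ^ 2
        + if i.2 ≠ 0 then ‖inner ℂ (dirichletMode i) (perComponent 2 u)‖ ^ 2 else 0) :=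
        Finset.sum_le_sum fun i _ => hterm i
    _ ≤ ‖u‖ ^ 2 := by
        rw [Finset.sum_add_distrib, norm_sq_sobolevPer]
        have := sq_nonneg ‖perComponent 0 u‖
        linarith

/-- `D` is the limit in operator norm, at rate `1 / N`, of the compact operators `F N ∘ D`. -/
theorem isCompactOperator_of_norm_sub_le {V H : Type*} [NormedAddCommGroup V] [NormedSpace ℂ V]
    [NormedAddCommGroup H] [NormedSpace ℂ H] [CompleteSpace H] (D : V →L[ℂ] H)
    {F : ℕ → H →L[ℂ] H} (hF : ∀ N, IsCompactOperator (F N))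
    (h : ∀ (N : ℕ) u, (N : ℝ) * ‖D u - F N (D u)‖ ≤ ‖u‖) : IsCompactOperator D := by
  refine isCompactOperator_of_tendsto (l := atTop) (F := fun N : ℕ => (F N).comp D) ?_
    (Eventually.of_forall fun N => (hF N).comp_clm D)
  rw [tendsto_iff_norm_sub_tendsto_zero]
  refine squeeze_zero' (Eventually.of_forall fun N => norm_nonneg _) ?_
    (tendsto_one_div_atTop_nhds_zero_nat (𝕜 := ℝ))
  filter_upwards [eventually_gt_atTop 0] with N hN
  have hN' : (0 : ℝ) < N := Nat.cast_pos.2 hN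
  refine ContinuousLinearMap.opNorm_le_bound _ (by positivity) fun u => ?_
  rw [sub_apply, ContinuousLinearMap.comp_apply, norm_sub_rev, one_div,
    inv_mul_eq_div, le_div_iff₀ hN', mul_comm]
  exact h N u

/-- The Rellich theorem: `H¹_per(Ω₀)` embeds compactly in `L²(Ω₀)`. -/
theorem isCompactOperator_perComponent_zero : IsCompactOperator (perComponent 0) := by
  refine isCompactOperator_of_norm_sub_le (perComponent 0) isCompactOperator_lowPass fun N u => ?_
  have h := norm_sq_sub_lowPass_le N u
  rw [← mul_pow] at h
  exact (pow_le_pow_iff_left₀ (by positivity) (norm_nonneg _) two_ne_zero).1 h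

/-! ### Multiplication operators -/

/-- Multiplication of `L²(Ω₀)` functions by `L^∞(Ω₀)` functions. -/
def mulOp : Lp ℂ ⊤ (volume.restrict cell) →L[ℂ] L2Cell →L[ℂ] L2Cell :=
  (ContinuousLinearMap.mul ℂ ℂ).holderL (volume.restrict cell) ⊤ 2 2

theorem coeFn_mulOp (φ : Lp ℂ ⊤ (volume.restrict cell)) (g : L2Cell) :
    mulOp φ g =ᵐ[volume.restrict cell] fun x => φ x * g x :=
  (ContinuousLinearMap.mul ℂ ℂ).coeFn_holder φ g

/-- The coordinate `x₁`, clipped to the width of the cell. -/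
def clippedFst : BoundedContinuousFunction (ℝ × ℝ) ℂ :=
  BoundedContinuousFunction.ofNormedAddCommGroup
    (fun x => ((max (-1 / 2) (min x.1 (1 / 2)) : ℝ) : ℂ)) (by fun_prop) (1 / 2) (fun x => by
      rw [Complex.norm_real, Real.norm_eq_abs, abs_le]
      constructor
      · exact le_trans (by norm_num) (le_max_left _ _)
      · exact max_le (by norm_num) (min_le_right _ _))

theorem clippedFst_apply {x : ℝ × ℝ} (hx : x ∈ cell) : clippedFst x = x.1 := by
  simp only [clippedFst, BoundedContinuousFunction.coe_ofNormedAddCommGroup]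
  rw [min_eq_left hx.1.2, max_eq_right hx.1.1.le]

/-- Evaluation at a point is a continuous ring homomorphism, so it commutes with the exponential
series. -/
theorem exp_smul_clippedFst_apply (l : ℂ) {x : ℝ × ℝ} (hx : x ∈ cell) :
    NormedSpace.exp (l • clippedFst) x = Complex.exp (l * x.1) := by
  let ev : BoundedContinuousFunction (ℝ × ℝ) ℂ →+* ℂ :=
    { toFun := fun f => f x
      map_one' := rfl
      map_mul' := fun _ _ => rfl
      map_zero' := rfl
      map_add' := fun _ _ => rfl }
  have hev : Continuous ev := continuous_eval_const x
  have h := NormedSpace.map_exp ev hev (l • clippedFst)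
  have h2 : ev (l • clippedFst) = l * x.1 := by
    rw [← clippedFst_apply hx]
    rfl
  rw [h2, ← Complex.exp_eq_exp_ℂ] at h
  exact h

/-- Multiplication by `exp (l x₁)` on `L²(Ω₀)`. -/
def expOp (l : ℂ) : L2Cell →L[ℂ] L2Cell :=
  mulOp (BoundedContinuousFunction.toLp ⊤ (volume.restrict cell) ℂ
    (NormedSpace.exp (l • clippedFst)))

theorem coeFn_expOp (l : ℂ) (g : L2Cell) :
    expOp l g =ᵐ[volume.restrict cell] fun x => Complex.exp (l * x.1) * g x := by
  filter_upwards [coeFn_mulOp (BoundedContinuousFunction.toLp ⊤ (volume.restrict cell) ℂ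
      (NormedSpace.exp (l • clippedFst))) g,
    BoundedContinuousFunction.coeFn_toLp (p := ⊤) (volume.restrict cell) ℂ
      (NormedSpace.exp (l • clippedFst)), ae_restrict_mem measurableSet_cell] with x h1 h2 hx
  rw [expOp, h1, h2, exp_smul_clippedFst_apply l hx]

/-- The multiplier is an exponential in the Banach algebra of bounded continuous functions, so the
dependence on `l` is holomorphic in operator norm and not merely at each vector. -/
theorem differentiable_expOp : Differentiable ℂ expOp := by
  have h : Differentiable ℂ fun l : ℂ => NormedSpace.exp (l • clippedFst) := fun l =>
    (hasDerivAt_exp_smul_const clippedFst l).differentiableAt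
  unfold expOp
  exact mulOp.differentiable.comp
    ((BoundedContinuousFunction.toLp ⊤ (volume.restrict cell) ℂ).differentiable.comp h)

theorem expOp_expOp_neg (l : ℂ) (g : L2Cell) : expOp l (expOp (-l) g) = g := by
  refine Lp.ext ?_
  filter_upwards [coeFn_expOp l (expOp (-l) g), coeFn_expOp (-l) g] with x h1 h2
  rw [h1, h2, ← mul_assoc, ← Complex.exp_add]
  simp

/-! ### The Fredholm alternative for the gauged form -/

section Abstract

open ContinuousLinearMap

variable {V H : Type*} [NormedAddCommGroup V] [InnerProductSpace ℂ V] [CompleteSpace V]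
  [NormedAddCommGroup H] [InnerProductSpace ℂ H] [CompleteSpace H]

/-- The operator on `V` of the sesquilinear form
`⟪D₁φ - conj l • D₀φ, D₁v + l • D₀v⟫ + ⟪D₂φ, D₂v⟫ - ⟪D₀φ, Q D₀v⟫`. -/
def gaugedOperator (D : Fin 3 → V →L[ℂ] H) (Q : H →L[ℂ] H) (l : ℂ) : V →L[ℂ] V :=
  adjoint (D 1) ∘L D 1 + adjoint (D 2) ∘L D 2
    + l • (adjoint (D 1) ∘L D 0 - adjoint (D 0) ∘L D 1) - l ^ 2 • (adjoint (D 0) ∘L D 0)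
    - adjoint (D 0) ∘L Q ∘L D 0

theorem inner_gaugedOperator (D : Fin 3 → V →L[ℂ] H) (Q : H →L[ℂ] H) (l : ℂ) (φ v : V) :
    inner ℂ φ (gaugedOperator D Q l v)
      = inner ℂ (D 1 φ - starRingEnd ℂ l • D 0 φ) (D 1 v + l • D 0 v) + inner ℂ (D 2 φ) (D 2 v)
        - inner ℂ (D 0 φ) (Q (D 0 v)) := by
  simp only [gaugedOperator, sub_apply, add_apply, smul_apply, ContinuousLinearMap.comp_apply,
    inner_sub_right, inner_add_right, inner_smul_right, adjoint_inner_right, inner_sub_left,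
    inner_smul_left, Complex.conj_conj]
  ring

/-- The conjugate of `l` stands in the conjugate-linear slot of the form, so only powers of `l`
itself survive. -/
theorem differentiable_gaugedOperator (D : Fin 3 → V →L[ℂ] H) (Q : H →L[ℂ] H) :
    Differentiable ℂ (gaugedOperator D Q) := by
  unfold gaugedOperator
  fun_prop

/-- The cross terms are at most `2 ‖l‖ ‖D₀u‖ ‖D₁u‖ ≤ ‖D₁u‖² / 2 + 2 ‖l‖² ‖D₀u‖²`. With `‖l‖²` from
the quadratic term and `‖Q‖` from the potential this consumes `3 ‖l‖² + ‖Q‖` of the shift; the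
remaining `1` controls `‖D₀u‖²`. -/
theorem coercive_gaugedOperator {D : Fin 3 → V →L[ℂ] H}
    (hD : ∀ u, ‖u‖ ^ 2 = ‖D 0 u‖ ^ 2 + ‖D 1 u‖ ^ 2 + ‖D 2 u‖ ^ 2) (Q : H →L[ℂ] H) (l : ℂ) (u : V) :
    1 / 2 * ‖u‖ ^ 2 ≤ (inner ℂ u ((gaugedOperator D Q l
      + ((3 * ‖l‖ ^ 2 + ‖Q‖ + 1 : ℝ) : ℂ) • (adjoint (D 0) ∘L D 0)) u)).re := by
  set s : ℝ := 3 * ‖l‖ ^ 2 + ‖Q‖ + 1 with hs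
  have e : inner ℂ u ((gaugedOperator D Q l + (s : ℂ) • (adjoint (D 0) ∘L D 0)) u)
      = inner ℂ (D 1 u) (D 1 u) + inner ℂ (D 2 u) (D 2 u)
        + (l * inner ℂ (D 1 u) (D 0 u) - l * inner ℂ (D 0 u) (D 1 u)
          - l ^ 2 * inner ℂ (D 0 u) (D 0 u) - inner ℂ (D 0 u) (Q (D 0 u)))
        + (s : ℂ) * inner ℂ (D 0 u) (D 0 u) := by
    rw [add_apply, inner_add_right, inner_gaugedOperator]
    simp only [smul_apply, ContinuousLinearMap.comp_apply, inner_add_right, inner_smul_right,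
      adjoint_inner_right, inner_sub_left, inner_smul_left, Complex.conj_conj]
    ring
  have hre : ∀ x : H, inner ℂ x x = ((‖x‖ ^ 2 : ℝ) : ℂ) := fun x => by
    rw [inner_self_eq_norm_sq_to_K]
    push_cast
    rfl
  have hX : ‖l * inner ℂ (D 1 u) (D 0 u) - l * inner ℂ (D 0 u) (D 1 u)
          - l ^ 2 * inner ℂ (D 0 u) (D 0 u) - inner ℂ (D 0 u) (Q (D 0 u))‖
      ≤ ‖l‖ * (‖D 1 u‖ * ‖D 0 u‖) + ‖l‖ * (‖D 0 u‖ * ‖D 1 u‖)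
        + ‖l‖ ^ 2 * (‖D 0 u‖ * ‖D 0 u‖) + ‖D 0 u‖ * (‖Q‖ * ‖D 0 u‖) := by
    refine (norm_sub_le _ _).trans (add_le_add ((norm_sub_le _ _).trans
      (add_le_add ((norm_sub_le _ _).trans (add_le_add ?_ ?_)) ?_)) ?_)
    · rw [norm_mul]
      exact mul_le_mul_of_nonneg_left (norm_inner_le_norm _ _) (norm_nonneg _)
    · rw [norm_mul]
      exact mul_le_mul_of_nonneg_left (norm_inner_le_norm _ _) (norm_nonneg _)
    · rw [norm_mul, norm_pow]
      exact mul_le_mul_of_nonneg_left (norm_inner_le_norm _ _) (by positivity)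
    · exact (norm_inner_le_norm _ _).trans
        (mul_le_mul_of_nonneg_left (Q.le_opNorm _) (norm_nonneg _))
  have hX' := (abs_le.1 ((Complex.abs_re_le_norm _).trans hX)).1
  rw [e, Complex.add_re, Complex.add_re, Complex.add_re, hre, hre, hre (D 0 u),
    ← Complex.ofReal_mul, Complex.ofReal_re, Complex.ofReal_re, Complex.ofReal_re]
  rw [hre (D 0 u)] at hX'
  have hy := sq_nonneg (‖D 1 u‖ - 2 * ‖l‖ * ‖D 0 u‖)
  rw [hD u, hs]
  nlinarith [sq_nonneg ‖D 0 u‖, sq_nonneg ‖D 2 u‖]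

/-- The Fredholm alternative for the gauged operator. -/
theorem isUnit_gaugedOperator {D : Fin 3 → V →L[ℂ] H}
    (hD : ∀ u, ‖u‖ ^ 2 = ‖D 0 u‖ ^ 2 + ‖D 1 u‖ ^ 2 + ‖D 2 u‖ ^ 2) (hK : IsCompactOperator (D 0))
    (Q : H →L[ℂ] H) (l : ℂ) (hinj : ∀ v, gaugedOperator D Q l v = 0 → v = 0) :
    IsUnit (gaugedOperator D Q l) := by
  set s : ℝ := 3 * ‖l‖ ^ 2 + ‖Q‖ + 1 with hs
  set B : V →L[ℂ] V := gaugedOperator D Q l + (s : ℂ) • (adjoint (D 0) ∘L D 0) with hB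
  have hBu : IsUnit B := by
    refine isUnit_of_forall_le_norm_inner_map B (c := 1 / 2) (by norm_num) fun u => ?_
    have h1 := coercive_gaugedOperator hD Q l u
    have h2 := Complex.re_le_norm (inner ℂ u (B u))
    rw [← norm_inner_symm] at h2
    have h3 : ((1 / 2 : NNReal) : ℝ) = 1 / 2 := by simp
    rw [h3]
    linarith
  obtain ⟨b, hb⟩ := hBu
  have hinv : ∀ x, B ((↑b⁻¹ : V →L[ℂ] V) x) = x := fun x => by
    have h : (b : V →L[ℂ] V) * (↑b⁻¹ : V →L[ℂ] V) = 1 := b.mul_inv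
    rw [hb] at h
    exact congrArg (fun f : V →L[ℂ] V => f x) h
  set K : V →L[ℂ] V := (s : ℂ) • ((↑b⁻¹ : V →L[ℂ] V) ∘L (adjoint (D 0) ∘L D 0)) with hKdef
  have hKc : IsCompactOperator K := by
    have h1 : IsCompactOperator ((↑b⁻¹ : V →L[ℂ] V) ∘L (adjoint (D 0) ∘L D 0)) :=
      (hK.clm_comp (adjoint (D 0))).clm_comp (↑b⁻¹ : V →L[ℂ] V)
    exact h1.smul (s : ℂ)
  -- With `K = s B⁻¹ D₀* D₀` compact, invertibility is the question whether `1` is an eigenvalue of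
  -- `K`, and an eigenvector would lie in the kernel of the gauged operator.
  have hfac : gaugedOperator D Q l = B * (algebraMap ℂ (V →L[ℂ] V) 1 - K) := by
    ext x
    rw [map_one, ContinuousLinearMap.mul_def, ContinuousLinearMap.comp_apply, sub_apply,
      one_apply_eq_self, map_sub, hKdef, smul_apply, map_smul,
      ContinuousLinearMap.comp_apply, hinv, hB]
    simp
  rcases hKc.hasEigenvalue_or_mem_resolventSet one_ne_zero with h | h
  · obtain ⟨x, hx⟩ := h.exists_hasEigenvector
    refine absurd (hinj x ?_) hx.2
    have h1 : K x = x := by simpa using hx.apply_eq_smul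
    rw [hfac, ContinuousLinearMap.mul_def, ContinuousLinearMap.comp_apply, sub_apply, map_one,
      one_apply_eq_self, h1, sub_self, map_zero]
  · rw [hfac, ← hb]
    exact b.isUnit.mul h

end Abstract

/-! ### The gauge transformation and complex conjugation -/

/-- Multiplication by `exp (l x₁)` of a function, acting on the function and its gradient. -/
def gaugeTriple (l : ℂ) : L2Triple →L[ℂ] L2Triple :=
  (PiLp.continuousLinearEquiv 2 ℂ (fun _ : Fin 3 => L2Cell)).symm.toContinuousLinearMap ∘L
    (ContinuousLinearMap.single ℂ (fun _ : Fin 3 => L2Cell) 0 ∘L expOp l ∘L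
        PiLp.proj (𝕜 := ℂ) 2 (fun _ : Fin 3 => L2Cell) 0
      + ContinuousLinearMap.single ℂ (fun _ : Fin 3 => L2Cell) 1 ∘L expOp l ∘L
        (PiLp.proj (𝕜 := ℂ) 2 (fun _ : Fin 3 => L2Cell) 1
          + l • PiLp.proj (𝕜 := ℂ) 2 (fun _ : Fin 3 => L2Cell) 0)
      + ContinuousLinearMap.single ℂ (fun _ : Fin 3 => L2Cell) 2 ∘L expOp l ∘L
        PiLp.proj (𝕜 := ℂ) 2 (fun _ : Fin 3 => L2Cell) 2)

theorem gaugeTriple_zero (l : ℂ) (u : L2Triple) : gaugeTriple l u 0 = expOp l (u 0) := by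
  simp [gaugeTriple]

theorem gaugeTriple_one (l : ℂ) (u : L2Triple) :
    gaugeTriple l u 1 = expOp l (u 1 + l • u 0) := by
  simp [gaugeTriple]

theorem gaugeTriple_two (l : ℂ) (u : L2Triple) : gaugeTriple l u 2 = expOp l (u 2) := by
  simp [gaugeTriple]

theorem differentiable_gaugeTriple : Differentiable ℂ gaugeTriple := by
  have := differentiable_expOp
  unfold gaugeTriple
  fun_prop

theorem gaugeTriple_gaugeTriple_neg (l : ℂ) (u : L2Triple) :
    gaugeTriple l (gaugeTriple (-l) u) = u := by
  ext1 i
  fin_cases i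
  · simp only [Fin.zero_eta, gaugeTriple_zero, expOp_expOp_neg]
  · simp only [Fin.mk_one, gaugeTriple_one, gaugeTriple_zero, ← map_smul, ← map_add,
      expOp_expOp_neg]
    simp
  · simp only [Fin.reduceFinMk, gaugeTriple_two, expOp_expOp_neg]

theorem contDiff_exp_fst (l : ℂ) : ContDiff ℝ ∞ fun x : ℝ × ℝ => Complex.exp (l * x.1) :=
  (contDiff_const.mul (Complex.ofRealCLM.contDiff.comp contDiff_fst)).cexp

theorem fderiv_exp_fst (l : ℂ) (x e : ℝ × ℝ) :
    fderiv ℝ (fun x : ℝ × ℝ => Complex.exp (l * x.1)) x e = l * e.1 * Complex.exp (l * x.1) := by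
  have h1 : HasFDerivAt (fun x : ℝ × ℝ => (x.1 : ℂ)) _ x :=
    Complex.ofRealCLM.hasFDerivAt.comp x hasFDerivAt_fst
  have h2 : HasFDerivAt (fun x : ℝ × ℝ => Complex.exp (l * x.1)) _ x := (h1.const_mul l).cexp
  rw [h2.fderiv]
  simp
  ring

/-- On the `n`-th translate of the cell, `exp (l x₁)` splits into `(exp l) ^ n` and the gauge factor
at the folded point. -/
theorem qpExt_exp_mul (l z : ℂ) (g : ℝ × ℝ → ℂ) (x : ℝ × ℝ) :
    qpExt (Complex.exp l * z) (fun x => Complex.exp (l * x.1) * g x) x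
      = Complex.exp (l * x.1) * qpExt z g x := by
  simp only [qpExt]
  rw [mul_zpow, ← Complex.exp_int_mul]
  have h : Complex.exp (l * x.1) = Complex.exp (⌈x.1 - 1 / 2⌉ * l)
      * Complex.exp (l * ((x.1 - ⌈x.1 - 1 / 2⌉ : ℝ) : ℂ)) := by
    rw [← Complex.exp_add]
    congr 1
    push_cast
    ring
  rw [h]
  ring

theorem coeFn_gaugeTriple_one (l : ℂ) (u : L2Triple) :
    gaugeTriple l u 1 =ᵐ[volume.restrict cell]
      fun x => Complex.exp (l * x.1) * (u 1 x + l * u 0 x) := by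
  rw [gaugeTriple_one]
  filter_upwards [coeFn_expOp l (u 1 + l • u 0), Lp.coeFn_add (u 1) (l • u 0),
    Lp.coeFn_smul l (u 0)] with x h1 h2 h3
  rw [h1, h2, Pi.add_apply, h3, Pi.smul_apply, smul_eq_mul]

theorem coeFn_gaugeTriple_zero (l : ℂ) (u : L2Triple) :
    gaugeTriple l u 0 =ᵐ[volume.restrict cell] fun x => Complex.exp (l * x.1) * u 0 x := by
  rw [gaugeTriple_zero]
  exact coeFn_expOp l (u 0)

theorem coeFn_gaugeTriple_two (l : ℂ) (u : L2Triple) :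
    gaugeTriple l u 2 =ᵐ[volume.restrict cell] fun x => Complex.exp (l * x.1) * u 2 x := by
  rw [gaugeTriple_two]
  exact coeFn_expOp l (u 2)

theorem gaugeTriple_mem (l : ℂ) {u : L2Triple} (hu : u ∈ H1Cell) : gaugeTriple l u ∈ H1Cell := by
  have hr : ∀ {f g : ℝ × ℝ → ℂ}, f =ᵐ[volume.restrict cell] g →
      g =ᵐ[volume.restrict cellInterior] f := fun h =>
    (ae_restrict_of_ae_restrict_of_subset cellInterior_subset_cell h.symm)
  have h1 := hu.1.smooth_mul isOpen_cellInterior (contDiff_exp_fst l)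
  have h2 := hu.2.smooth_mul isOpen_cellInterior (contDiff_exp_fst l)
  simp only [fderiv_exp_fst] at h1 h2
  refine ⟨h1.congr (hr (coeFn_gaugeTriple_zero l u)) (EventuallyEq.trans
    (Eventually.of_forall fun x => ?_) (hr (coeFn_gaugeTriple_one l u))),
    h2.congr (hr (coeFn_gaugeTriple_zero l u)) (EventuallyEq.trans
    (Eventually.of_forall fun x => ?_) (hr (coeFn_gaugeTriple_two l u)))⟩
  · push_cast
    ring
  · push_cast
    ring

/-- Multiplication by `exp (l x₁)` on `H¹(Ω₀)`. -/
def gaugeCell (l : ℂ) (u : H1Cell) : H1Cell := ⟨gaugeTriple l u, gaugeTriple_mem l u.2⟩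

theorem gaugeCell_gaugeCell_neg (l : ℂ) (u : H1Cell) : gaugeCell l (gaugeCell (-l) u) = u :=
  Subtype.ext (gaugeTriple_gaugeTriple_neg l u)

theorem gaugeCell_neg_gaugeCell (l : ℂ) (u : H1Cell) : gaugeCell (-l) (gaugeCell l u) = u := by
  have h := gaugeCell_gaugeCell_neg (-l) u
  rwa [neg_neg] at h

theorem gaugeCell_mem (l : ℂ) {z : ℂ} {u : H1Cell} (hu : u ∈ H1qp z) :
    gaugeCell l u ∈ H1qp (Complex.exp l * z) := by
  have h1 := hu.1.smooth_mul isOpen_guideInterior (contDiff_exp_fst l)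
  have h2 := hu.2.smooth_mul isOpen_guideInterior (contDiff_exp_fst l)
  simp only [fderiv_exp_fst] at h1 h2
  have hr : ∀ {f g : ℝ × ℝ → ℂ}, f =ᵐ[volume.restrict cell] (fun x => Complex.exp (l * x.1) * g x) →
      (fun x => Complex.exp (l * x.1) * qpExt z g x) =ᵐ[volume.restrict guideInterior]
        qpExt (Complex.exp l * z) f := fun {f g} h => by
    have := (qpExt_congr (Complex.exp l * z) h).symm
    refine EventuallyEq.trans (Eventually.of_forall fun x => ?_) this
    exact (qpExt_exp_mul l z g x).symm
  refine ⟨h1.congr (hr (coeFn_gaugeTriple_zero l u)) (EventuallyEq.trans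
    (Eventually.of_forall fun x => ?_) (hr (coeFn_gaugeTriple_one l u))),
    h2.congr (hr (coeFn_gaugeTriple_zero l u)) (EventuallyEq.trans
    (Eventually.of_forall fun x => ?_) (hr (coeFn_gaugeTriple_two l u)))⟩
  · simp only [qpExt]
    push_cast
    ring
  · push_cast
    ring

theorem fn_gaugeCell (l : ℂ) (u : H1Cell) :
    fn (gaugeCell l u) =ᵐ[volume.restrict cell] fun x => Complex.exp (l * x.1) * fn u x :=
  coeFn_gaugeTriple_zero l u

theorem d1_gaugeCell (l : ℂ) (u : H1Cell) :
    d1 (gaugeCell l u) =ᵐ[volume.restrict cell]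
      fun x => Complex.exp (l * x.1) * (d1 u x + l * fn u x) :=
  coeFn_gaugeTriple_one l u

theorem d2_gaugeCell (l : ℂ) (u : H1Cell) :
    d2 (gaugeCell l u) =ᵐ[volume.restrict cell] fun x => Complex.exp (l * x.1) * d2 u x :=
  coeFn_gaugeTriple_two l u

/-- Complex conjugation on triples. -/
def starTriple (u : L2Triple) : L2Triple := WithLp.toLp 2 fun i => star (u i)

theorem coeFn_starTriple (u : L2Triple) (i : Fin 3) :
    starTriple u i =ᵐ[volume.restrict cell] fun x => starRingEnd ℂ (u i x) :=
  Lp.coeFn_star (u i)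

theorem starTriple_mem {u : L2Triple} (hu : u ∈ H1Cell) : starTriple u ∈ H1Cell := by
  have hr : ∀ i, (fun x => starRingEnd ℂ (u i x)) =ᵐ[volume.restrict cellInterior]
      starTriple u i := fun i =>
    ae_restrict_of_ae_restrict_of_subset cellInterior_subset_cell (coeFn_starTriple u i).symm
  exact ⟨hu.1.star.congr (hr 0) (hr 1), hu.2.star.congr (hr 0) (hr 2)⟩

/-- Complex conjugation on `H¹(Ω₀)`. -/
def starCell (u : H1Cell) : H1Cell := ⟨starTriple u, starTriple_mem u.2⟩

theorem fn_starCell (u : H1Cell) :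
    fn (starCell u) =ᵐ[volume.restrict cell] fun x => starRingEnd ℂ (fn u x) :=
  coeFn_starTriple u 0

theorem d1_starCell (u : H1Cell) :
    d1 (starCell u) =ᵐ[volume.restrict cell] fun x => starRingEnd ℂ (d1 u x) :=
  coeFn_starTriple u 1

theorem d2_starCell (u : H1Cell) :
    d2 (starCell u) =ᵐ[volume.restrict cell] fun x => starRingEnd ℂ (d2 u x) :=
  coeFn_starTriple u 2

theorem starCell_starCell (u : H1Cell) : starCell (starCell u) = u := by
  refine Subtype.ext ?_
  ext1 i
  exact star_star ((u : L2Triple) i)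

/-- Periodicity survives conjugation because the multiplier `1` is real. -/
theorem starCell_mem {u : H1Cell} (hu : u ∈ H1per) : starCell u ∈ H1per := by
  have hr : ∀ i, (fun x => starRingEnd ℂ (qpExt 1 ((u : L2Triple) i) x))
      =ᵐ[volume.restrict guideInterior] qpExt 1 (starTriple u i) := fun i => by
    refine EventuallyEq.trans (Eventually.of_forall fun x => ?_)
      (qpExt_congr 1 (coeFn_starTriple u i).symm)
    simp [qpExt]
  exact ⟨hu.1.star.congr (hr 0) (hr 1), hu.2.star.congr (hr 0) (hr 2)⟩

theorem mem_H1per_iff_gaugeCell (l : ℂ) (u : H1Cell) :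
    u ∈ H1per ↔ gaugeCell l u ∈ H1qp (Complex.exp l) := by
  constructor
  · intro h
    have := gaugeCell_mem l h
    rwa [mul_one] at this
  · intro h
    have := gaugeCell_mem (-l) h
    rwa [gaugeCell_neg_gaugeCell, ← Complex.exp_add, neg_add_cancel, Complex.exp_zero] at this

/-- An element of `H¹_per(Ω₀)` from its underlying element of `H¹(Ω₀)`. -/
def SobolevPer.mk (u : H1Cell) (hu : u ∈ H1per) : SobolevPer := (⟨u, hu⟩ : H1per)

/-- The underlying element of `H¹(Ω₀)` of an element of `H¹_per(Ω₀)`. -/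
def SobolevPer.val (u : SobolevPer) : H1Cell := Subtype.val (p := (· ∈ H1per)) u

theorem SobolevPer.val_mem (u : SobolevPer) : u.val ∈ H1per := Subtype.prop (p := (· ∈ H1per)) u

/-! ### The weak formulation as an operator equation -/

theorem coeFn_smul_L2Cell (c : ℂ) (g : L2Cell) :
    (c • g : L2Cell) =ᵐ[volume.restrict cell] fun x => c * g x := Lp.coeFn_smul c g

/-- The sesquilinear form of the gauged operator as the integral in the weak formulation. -/
theorem integral_form_eq (k : ℝ) {q : ℝ × ℝ → ℝ} {Q : L2Cell →L[ℂ] L2Cell}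
    (hQ : ∀ g, Q g =ᵐ[volume.restrict cell] fun x => (k : ℂ) ^ 2 * (q x : ℂ) * g x) (l : ℂ)
    (v φ : SobolevPer) :
    ∫ x in cell, (d1 (gaugeCell l v.val) x * d1 (gaugeCell (-l) (starCell φ.val)) x
        + d2 (gaugeCell l v.val) x * d2 (gaugeCell (-l) (starCell φ.val)) x
        - (k : ℂ) ^ 2 * (q x : ℂ) * fn (gaugeCell l v.val) x
          * fn (gaugeCell (-l) (starCell φ.val)) x)
      = inner ℂ φ (gaugedOperator perComponent Q l v) := by
  rw [inner_gaugedOperator, L2.inner_def, L2.inner_def, L2.inner_def,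
    ← integral_add (L2.integrable_inner _ _) (L2.integrable_inner _ _), ← integral_sub
      ((L2.integrable_inner _ _).add (L2.integrable_inner _ _)) (L2.integrable_inner _ _)]
  refine integral_congr_ae ?_
  filter_upwards [fn_gaugeCell l v.val, d1_gaugeCell l v.val, d2_gaugeCell l v.val,
    fn_gaugeCell (-l) (starCell φ.val), d1_gaugeCell (-l) (starCell φ.val),
    d2_gaugeCell (-l) (starCell φ.val), fn_starCell φ.val, d1_starCell φ.val, d2_starCell φ.val,
    hQ (perComponent 0 v), Lp.coeFn_add (perComponent 1 v) (l • perComponent 0 v),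
    coeFn_smul_L2Cell l (perComponent 0 v),
    Lp.coeFn_sub (perComponent 1 φ) (starRingEnd ℂ l • perComponent 0 φ),
    coeFn_smul_L2Cell (starRingEnd ℂ l) (perComponent 0 φ)]
    with x h1 h2 h3 h4 h5 h6 h7 h8 h9 h10 h11 h12 h13 h14
  -- Solution and test function carry opposite gauges, so the integrand is periodic and only the
  -- shifts `±l` of `∂₁` remain.
  have e : Complex.exp (l * x.1) * Complex.exp (-l * x.1) = 1 := by
    rw [← Complex.exp_add]
    simp
  rw [h1, h2, h3, h4, h5, h6, h7, h8, h9, h10, h11, h13, Pi.add_apply, Pi.sub_apply, h12, h14]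
  simp only [RCLike.inner_apply, map_sub, map_mul, Complex.conj_conj]
  change _ = (d1 v.val x + l * fn v.val x)
      * (starRingEnd ℂ (d1 φ.val x) - l * starRingEnd ℂ (fn φ.val x))
    + d2 v.val x * starRingEnd ℂ (d2 φ.val x)
    - (k : ℂ) ^ 2 * (q x : ℂ) * fn v.val x * starRingEnd ℂ (fn φ.val x)
  linear_combination ((d1 v.val x + l * fn v.val x)
      * (starRingEnd ℂ (d1 φ.val x) - l * starRingEnd ℂ (fn φ.val x))
    + d2 v.val x * starRingEnd ℂ (d2 φ.val x)
    - (k : ℂ) ^ 2 * (q x : ℂ) * fn v.val x * starRingEnd ℂ (fn φ.val x)) * e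

theorem integral_source_eq (l : ℂ) (f : L2Cell) (φ : SobolevPer) :
    ∫ x in cell, f x * fn (gaugeCell (-l) (starCell φ.val)) x
      = inner ℂ φ (ContinuousLinearMap.adjoint (perComponent 0) (expOp (-l) f)) := by
  rw [ContinuousLinearMap.adjoint_inner_right, L2.inner_def]
  refine integral_congr_ae ?_
  filter_upwards [fn_gaugeCell (-l) (starCell φ.val), fn_starCell φ.val, coeFn_expOp (-l) f]
    with x h1 h2 h3
  rw [h1, h2, h3, RCLike.inner_apply]
  change _ = Complex.exp (-l * x.1) * f x * starRingEnd ℂ (fn φ.val x)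
  ring

/-- The weak formulation as an operator equation in `H¹_per(Ω₀)`. -/
theorem isQPSolution_gaugeCell_iff {k : ℝ} {q : ℝ × ℝ → ℝ} {Q : L2Cell →L[ℂ] L2Cell}
    (hQ : ∀ g, Q g =ᵐ[volume.restrict cell] fun x => (k : ℂ) ^ 2 * (q x : ℂ) * g x) (l : ℂ)
    (f : L2Cell) (v : SobolevPer) :
    IsQPSolution k q (Complex.exp l) f (gaugeCell l v.val) ↔
      gaugedOperator perComponent Q l v
        = -(ContinuousLinearMap.adjoint (perComponent 0) (expOp (-l) f)) := by
  constructor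
  · intro h
    refine ext_inner_left ℂ fun φ => ?_
    have h1 := h.2 (gaugeCell (-l) (starCell φ.val)) (by
      rw [← Complex.exp_neg]
      exact (mem_H1per_iff_gaugeCell (-l) _).1 (starCell_mem φ.val_mem))
    rw [integral_form_eq k hQ, integral_source_eq] at h1
    rw [h1, inner_neg_right]
  · intro h
    refine ⟨(mem_H1per_iff_gaugeCell l _).1 v.val_mem, fun χ hχ => ?_⟩
    have hχ' : gaugeCell l χ ∈ H1per := by
      rw [mem_H1per_iff_gaugeCell (-l), gaugeCell_neg_gaugeCell, Complex.exp_neg]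
      exact hχ
    -- Every `z⁻¹`-quasi-periodic test function is the gauged conjugate of a periodic one, so no
    -- test function is lost.
    set φ : SobolevPer := SobolevPer.mk (starCell (gaugeCell l χ)) (starCell_mem hχ') with hφ
    have hval : gaugeCell (-l) (starCell φ.val) = χ := by
      have : φ.val = starCell (gaugeCell l χ) := rfl
      rw [this, starCell_starCell, gaugeCell_neg_gaugeCell]
    have h1 := integral_form_eq k hQ l v φ
    have h2 := integral_source_eq l f φ
    rw [hval] at h1 h2
    rw [h1, h2, h, inner_neg_right]

/-! ### The solution operator and its holomorphy -/

/-- Multiplication by `exp (l x₁)` as an operator on the Hilbert space `H¹(Ω₀)`. -/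
def gaugeMap (l : ℂ) : SobolevCell →L[ℂ] SobolevCell :=
  ContinuousLinearMap.adjoint SobolevCell.toTriple.toContinuousLinearMap ∘L gaugeTriple l ∘L
    SobolevCell.toTriple.toContinuousLinearMap

/-- The adjoint of an isometry is a left inverse. Composing with it brings `gaugeTriple l` back to
`H¹(Ω₀)` through an operator independent of `l`, so holomorphy is inherited. -/
theorem adjoint_toTriple (u : SobolevCell) :
    ContinuousLinearMap.adjoint SobolevCell.toTriple.toContinuousLinearMap
      (SobolevCell.toTriple u) = u :=
  ext_inner_left ℂ fun w => by
    rw [ContinuousLinearMap.adjoint_inner_right]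
    exact SobolevCell.toTriple.inner_map_map w u

theorem gaugeMap_apply (l : ℂ) (u : H1Cell) :
    gaugeMap l (show SobolevCell from u) = (show SobolevCell from gaugeCell l u) :=
  adjoint_toTriple (show SobolevCell from gaugeCell l u)

theorem differentiable_gaugeMap : Differentiable ℂ gaugeMap := by
  have := differentiable_gaugeTriple
  unfold gaugeMap
  fun_prop

/-- The periodic part `exp (-l x₁) w` of the solution of the quasi-periodic problem. -/
def perSolution (Q : L2Cell →L[ℂ] L2Cell) (l : ℂ) : L2Cell →L[ℂ] SobolevPer :=
  -(Ring.inverse (gaugedOperator perComponent Q l) ∘L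
    ContinuousLinearMap.adjoint (perComponent 0) ∘L expOp (-l))

/-- The solution of the quasi-periodic problem. -/
def cellSolution (Q : L2Cell →L[ℂ] L2Cell) (l : ℂ) : L2Cell →L[ℂ] SobolevCell :=
  gaugeMap l ∘L SobolevPer.incl.toContinuousLinearMap ∘L perSolution Q l

theorem cellSolution_apply (Q : L2Cell →L[ℂ] L2Cell) (l : ℂ) (f : L2Cell) :
    cellSolution Q l f = (show SobolevCell from gaugeCell l (perSolution Q l f).val) :=
  gaugeMap_apply l (perSolution Q l f).val

theorem differentiableAt_perSolution {Q : L2Cell →L[ℂ] L2Cell} {l : ℂ}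
    (h : IsUnit (gaugedOperator perComponent Q l)) : DifferentiableAt ℂ (perSolution Q) l := by
  have h1 : DifferentiableAt ℂ (fun l => Ring.inverse (gaugedOperator perComponent Q l)) l :=
    (differentiableAt_inverse h).comp l (differentiable_gaugedOperator perComponent Q l)
  have h2 : DifferentiableAt ℂ (fun l => expOp (-l)) l :=
    (differentiable_expOp (-l)).comp l differentiableAt_id.neg
  unfold perSolution
  exact (h1.clm_comp ((differentiableAt_const _).clm_comp h2)).neg

theorem differentiableAt_cellSolution {Q : L2Cell →L[ℂ] L2Cell} {l : ℂ}
    (h : IsUnit (gaugedOperator perComponent Q l)) : DifferentiableAt ℂ (cellSolution Q) l := by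
  unfold cellSolution
  exact (differentiable_gaugeMap l).clm_comp
    ((differentiableAt_const _).clm_comp (differentiableAt_perSolution h))

theorem eventually_isUnit_gaugedOperator {Q : L2Cell →L[ℂ] L2Cell} {l : ℂ}
    (h : IsUnit (gaugedOperator perComponent Q l)) :
    ∀ᶠ l' in 𝓝 l, IsUnit (gaugedOperator perComponent Q l') :=
  (differentiable_gaugedOperator perComponent Q).continuous.continuousAt.eventually
    (Units.isOpen.mem_nhds h)

/-- Invertibility is an open condition, so complex differentiability holds on a whole neighbourhood
and gives analyticity. -/
theorem analyticAt_perSolution {Q : L2Cell →L[ℂ] L2Cell} {l : ℂ}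
    (h : IsUnit (gaugedOperator perComponent Q l)) : AnalyticAt ℂ (perSolution Q) l :=
  DifferentiableOn.analyticAt (s := {l | IsUnit (gaugedOperator perComponent Q l)})
    (fun _ hl => (differentiableAt_perSolution hl).differentiableWithinAt)
    (eventually_isUnit_gaugedOperator h)

theorem analyticAt_cellSolution {Q : L2Cell →L[ℂ] L2Cell} {l : ℂ}
    (h : IsUnit (gaugedOperator perComponent Q l)) : AnalyticAt ℂ (cellSolution Q) l :=
  DifferentiableOn.analyticAt (s := {l | IsUnit (gaugedOperator perComponent Q l)})
    (fun _ hl => (differentiableAt_cellSolution hl).differentiableWithinAt)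
    (eventually_isUnit_gaugedOperator h)

theorem gaugeCell_val_ne_zero (l : ℂ) {v : SobolevPer} (hv : v ≠ 0) : gaugeCell l v.val ≠ 0 := by
  intro h
  refine hv ?_
  have h1 := gaugeCell_neg_gaugeCell l v.val
  rw [h] at h1
  have h2 : gaugeCell (-l) 0 = 0 := Subtype.ext (map_zero (gaugeTriple (-l)))
  rw [h2] at h1
  exact Subtype.ext (p := (· ∈ H1per)) h1.symm

/-- A kernel element, multiplied by `exp (l x₁)`, is a nontrivial solution of the homogeneous
problem; the Fredholm alternative does the rest. -/
theorem isUnit_gaugedOperator_of_notMem {k : ℝ} {q : ℝ × ℝ → ℝ} {Q : L2Cell →L[ℂ] L2Cell}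
    (hQ : ∀ g, Q g =ᵐ[volume.restrict cell] fun x => (k : ℂ) ^ 2 * (q x : ℂ) * g x) {l : ℂ}
    (hl : Complex.exp l ∉ floquetMultipliers k q) :
    IsUnit (gaugedOperator perComponent Q l) := by
  refine isUnit_gaugedOperator norm_sq_sobolevPer isCompactOperator_perComponent_zero Q l
    fun v hv => ?_
  by_contra hne
  refine hl ⟨Complex.exp_ne_zero l, gaugeCell l v.val, gaugeCell_val_ne_zero l hne, ?_⟩
  rw [isQPSolution_gaugeCell_iff hQ, hv, map_zero, map_zero, neg_zero]

/-- Outside the set of Floquet multipliers the quasi-periodic problem is uniquely solvable. -/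
theorem isQPSolution_iff {k : ℝ} {q : ℝ × ℝ → ℝ} {Q : L2Cell →L[ℂ] L2Cell}
    (hQ : ∀ g, Q g =ᵐ[volume.restrict cell] fun x => (k : ℂ) ^ 2 * (q x : ℂ) * g x) {l : ℂ}
    (hl : Complex.exp l ∉ floquetMultipliers k q) (f : L2Cell) (u : H1Cell) :
    IsQPSolution k q (Complex.exp l) f u ↔ u = gaugeCell l (perSolution Q l f).val := by
  have hu := isUnit_gaugedOperator_of_notMem hQ hl
  have hsol : ∀ v : SobolevPer, gaugedOperator perComponent Q l v
      = -(ContinuousLinearMap.adjoint (perComponent 0) (expOp (-l) f)) ↔ v = perSolution Q l f := by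
    intro v
    have e : perSolution Q l f = Ring.inverse (gaugedOperator perComponent Q l)
        (-(ContinuousLinearMap.adjoint (perComponent 0) (expOp (-l) f))) :=
      (map_neg (Ring.inverse (gaugedOperator perComponent Q l)) _).symm
    rw [e]
    constructor
    · intro h
      rw [← h]
      exact (congrArg (fun B : SobolevPer →L[ℂ] SobolevPer => B v)
        (Ring.inverse_mul_cancel _ hu)).symm
    · intro h
      rw [h]
      exact congrArg (fun B : SobolevPer →L[ℂ] SobolevPer => B _) (Ring.mul_inverse_cancel _ hu)
  constructor
  · intro h
    have hm : gaugeCell (-l) u ∈ H1per := by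
      rw [mem_H1per_iff_gaugeCell l, gaugeCell_gaugeCell_neg]
      exact h.1
    have hv : gaugeCell l (SobolevPer.mk (gaugeCell (-l) u) hm).val = u :=
      gaugeCell_gaugeCell_neg l u
    rw [← hv, isQPSolution_gaugeCell_iff hQ, hsol] at h
    rw [← h, hv]
  · rintro rfl
    rw [isQPSolution_gaugeCell_iff hQ, hsol]

/-- Multiplication by the potential `k² q`. -/
theorem exists_potentialOp (k : ℝ) {q : ℝ × ℝ → ℝ}
    (hq_meas : AEStronglyMeasurable q (volume.restrict waveguide))
    (hq_pos : ∃ c > 0, ∀ᵐ x ∂(volume.restrict waveguide), c ≤ q x)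
    (hq_bdd : ∃ M, ∀ᵐ x ∂(volume.restrict waveguide), q x ≤ M) :
    ∃ Q : L2Cell →L[ℂ] L2Cell,
      ∀ g, Q g =ᵐ[volume.restrict cell] fun x => (k : ℂ) ^ 2 * (q x : ℂ) * g x := by
  have hsub : cell ⊆ waveguide := prod_mono (subset_univ _) subset_rfl
  obtain ⟨c, hc, hq1⟩ := hq_pos
  obtain ⟨M, hq2⟩ := hq_bdd
  have hm : MemLp (fun x => (k : ℂ) ^ 2 * (q x : ℂ)) ⊤ (volume.restrict cell) := by
    refine MemLp.of_bound ?_ (|k| ^ 2 * M) ?_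
    · exact (Complex.continuous_ofReal.comp_aestronglyMeasurable
        (hq_meas.mono_measure (Measure.restrict_mono hsub le_rfl))).const_mul _
    · filter_upwards [ae_restrict_of_ae_restrict_of_subset hsub hq1,
        ae_restrict_of_ae_restrict_of_subset hsub hq2] with x h1 h2
      rw [norm_mul, norm_pow, Complex.norm_real, Complex.norm_real, Real.norm_eq_abs,
        Real.norm_eq_abs, abs_of_pos (hc.trans_le h1)]
      exact mul_le_mul_of_nonneg_left h2 (by positivity)
  refine ⟨mulOp (hm.toLp _), fun g => ?_⟩
  filter_upwards [coeFn_mulOp (hm.toLp _) g, hm.coeFn_toLp] with x h1 h2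
  rw [h1, h2]

/-! ### Operator-valued curves and logarithms along a curve -/

section Curves

variable {E F : Type*} [NormedAddCommGroup E] [NormedSpace ℂ E] [NormedAddCommGroup F]
  [NormedSpace ℂ F]

/-- Evaluation of operators at a vector, as a real linear map. -/
def evalReal (f : E) : (E →L[ℂ] F) →L[ℝ] F := (ContinuousLinearMap.apply ℂ F f).restrictScalars ℝ

theorem analyticOn_eval {T : ℝ → E →L[ℂ] F} {s : Set ℝ} (hT : AnalyticOn ℝ T s) (f : E) :
    AnalyticOn ℝ (fun t => T t f) s :=
  (evalReal f : (E →L[ℂ] F) →L[ℝ] F).comp_analyticOn hT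

/-- Evaluation at `f` is linear and continuous, so it commutes with differentiation. `C` bounds the
operator norm of the derivative of `T` on the compact set, before any `f` is chosen. -/
theorem exists_bound_iteratedDerivWithin {T : ℝ → E →L[ℂ] F} {s : Set ℝ} (hs : IsCompact s)
    (hu : UniqueDiffOn ℝ s) (hT : ContDiffOn ℝ ∞ T s) (m : ℕ) :
    ∃ C : ℝ, ∀ f : E, ∀ t ∈ s, ‖iteratedDerivWithin m (fun r => T r f) s t‖ ≤ C * ‖f‖ := by
  have hTm : ContDiffOn ℝ m T s := hT.of_le (by exact_mod_cast le_top)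
  obtain ⟨C, hC⟩ := hs.exists_bound_of_continuousOn
    (hTm.continuousOn_iteratedDerivWithin (m := m) le_rfl hu)
  refine ⟨C, fun f t ht => ?_⟩
  have e : iteratedDerivWithin m (fun r => T r f) s t = iteratedDerivWithin m T s t f := by
    have h := (evalReal f : (E →L[ℂ] F) →L[ℝ] F).iteratedFDerivWithin_comp_left (hTm t ht) hu ht
      (i := m) le_rfl
    exact congrArg (fun A => A fun _ => (1 : ℝ)) h
  rw [e]
  exact (ContinuousLinearMap.le_opNorm _ f).trans
    (mul_le_mul_of_nonneg_right (hC t ht) (norm_nonneg f))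

theorem analyticOn_comp_curve {S : ℂ → F} {lam : ℝ → ℂ} {s : Set ℝ} (hlam : AnalyticOn ℝ lam s)
    (hS : ∀ t ∈ s, AnalyticAt ℂ S (lam t)) : AnalyticOn ℝ (fun t => S (lam t)) s := fun t ht =>
  ((hS t ht).restrictScalars (𝕜 := ℝ)).comp_analyticWithinAt (hlam t ht)

end Curves

/-- A continuous logarithm of a nonvanishing analytic curve is analytic. -/
theorem analyticOn_of_exp_eq {a lam : ℝ → ℂ} {s : Set ℝ} (ha : AnalyticOn ℝ a s)
    (hlam : ContinuousOn lam s) (h : ∀ t ∈ s, Complex.exp (lam t) = a t) : AnalyticOn ℝ lam s := by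
  intro t ht
  have hne : a t ≠ 0 := by
    rw [← h t ht]
    exact Complex.exp_ne_zero _
  have h1 : AnalyticWithinAt ℝ (fun r => a r / a t) s t :=
    (ha t ht).div analyticWithinAt_const hne
  have h2 : AnalyticAt ℝ Complex.log (a t / a t) := by
    rw [div_self hne]
    exact (analyticAt_clog Complex.one_mem_slitPlane).restrictScalars
  -- Near `t` the quotient is close to `1`, so the principal logarithm is analytic there whatever
  -- the branch `lam`.
  have h3 : AnalyticWithinAt ℝ (fun r => lam t + Complex.log (a r / a t)) s t :=
    analyticWithinAt_const.add
      (AnalyticAt.comp_analyticWithinAt (f := fun r => a r / a t) h2 h1)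
  refine AnalyticWithinAt.congr_of_eventuallyEq h3 ?_ (by simp [div_self hne])
  have hc : Tendsto (fun r => lam r - lam t) (𝓝[s] t) (𝓝 0) := by
    have := (hlam t ht).tendsto.sub_const (lam t)
    rwa [sub_self] at this
  -- Radius `π` keeps the imaginary part of `lam r - lam t` in the strip where `log` inverts `exp`.
  have hb := hc.eventually (Metric.ball_mem_nhds (0 : ℂ) Real.pi_pos)
  filter_upwards [hb, self_mem_nhdsWithin] with r hr hrs
  rw [dist_zero_right] at hr
  have him := abs_lt.1 ((Complex.abs_im_le_norm _).trans_lt hr)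
  rw [← h r hrs, ← h t ht, ← Complex.exp_sub, Complex.log_exp him.1 him.2.le]
  ring

/-- The curve, reparametrized over the unit interval, is lifted through the covering `exp : ℂ → ℂ \
{0}`. -/
theorem exists_continuousOn_log {a : ℝ → ℂ} (ha : ContinuousOn a (Icc (-1) 1))
    (h0 : ∀ t ∈ Icc (-1 : ℝ) 1, a t ≠ 0) :
    ∃ lam : ℝ → ℂ, ContinuousOn lam (Icc (-1) 1) ∧
      ∀ t ∈ Icc (-1 : ℝ) 1, Complex.exp (lam t) = a t := by
  have hmem : ∀ t : unitInterval, 2 * (t : ℝ) - 1 ∈ Icc (-1 : ℝ) 1 := fun t =>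
    ⟨by linarith [t.2.1], by linarith [t.2.2]⟩
  let γ : C(unitInterval, {z : ℂ // z ≠ 0}) :=
    { toFun := fun t => ⟨a (2 * (t : ℝ) - 1), h0 _ (hmem t)⟩
      continuous_toFun := (ha.comp_continuous (by fun_prop) hmem).subtype_mk _ }
  have hstart : γ 0 = (⟨_, (Complex.log (γ 0)).exp_ne_zero⟩ : {z : ℂ // z ≠ 0}) :=
    Subtype.ext (Complex.exp_log (γ 0).2).symm
  have hl := Complex.isCoveringMap_exp.liftPath_lifts γ (Complex.log (γ 0)) hstart
  set Γ := Complex.isCoveringMap_exp.liftPath γ (Complex.log (γ 0)) hstart with hΓ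
  refine ⟨fun t => Γ (projIcc 0 1 zero_le_one ((t + 1) / 2)), ?_, fun t ht => ?_⟩
  · exact (Γ.continuous.comp (continuous_projIcc.comp (by fun_prop))).continuousOn
  · have hm : (t + 1) / 2 ∈ Icc (0 : ℝ) 1 := ⟨by linarith [ht.1], by linarith [ht.2]⟩
    simp only [projIcc_of_mem zero_le_one hm]
    have h := congrArg Subtype.val (congrFun hl ⟨(t + 1) / 2, hm⟩)
    refine h.trans ?_
    change a (2 * ((t + 1) / 2) - 1) = a t
    congr 1
    ring

end PeriodicWaveguide

end

/-! ### The main theorem -/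

open PeriodicWaveguide in
theorem mainTheorem3 (k : ℝ) (hk : 0 < k) (q : ℝ × ℝ → ℝ)
    (hq_meas : AEStronglyMeasurable q (volume.restrict waveguide))
    (hq_per : ∀ n : ℤ, ∀ x ∈ waveguide, q (x.1 + n, x.2) = q x)
    (hq_pos : ∃ c > 0, ∀ᵐ x ∂(volume.restrict waveguide), c ≤ q x)
    (hq_bdd : ∃ M, ∀ᵐ x ∂(volume.restrict waveguide), q x ≤ M)
    (a : ℝ → ℂ) (ha : AnalyticOn ℝ a (Icc (-1) 1)) (ha_inj : InjOn a (Icc (-1) 1))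
    (ha_reg : ∀ t ∈ Icc (-1 : ℝ) 1, derivWithin a (Icc (-1) 1) t ≠ 0)
    (ha_avoid : ∀ t ∈ Icc (-1 : ℝ) 1, a t ∉ floquetMultipliers k q ∪ {0}) :
    -- `w z f` is the unique solution of the quasi-periodic problem
    ∃ w : ℂ → L2Cell → H1Cell,
      (∀ z ∉ floquetMultipliers k q ∪ {0}, ∀ (f : L2Cell) (u : H1Cell),
        IsQPSolution k q z f u ↔ u = w z f) ∧
      -- the claim for `w (a t) f`
      (∀ f : L2Cell, AnalyticOn ℝ (fun t => w (a t) f) (Icc (-1) 1)) ∧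
      (∀ m : ℕ, ∃ C : ℝ, ∀ f : L2Cell, ∀ t ∈ Icc (-1 : ℝ) 1,
        ‖iteratedDerivWithin m (fun s => w (a s) f) (Icc (-1) 1) t‖ ≤ C * ‖f‖) ∧
      -- there is a continuous branch `lam` of the logarithm along the curve, and for each one the
      -- claim holds for `v t f = exp (-x₁ lam(t)) * w (a t) f`
      (∃ lam : ℝ → ℂ, ContinuousOn lam (Icc (-1) 1) ∧
        ∀ t ∈ Icc (-1 : ℝ) 1, Complex.exp (lam t) = a t) ∧
      ∀ lam : ℝ → ℂ, ContinuousOn lam (Icc (-1) 1) →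
        (∀ t ∈ Icc (-1 : ℝ) 1, Complex.exp (lam t) = a t) →
        ∃ v : ℝ → L2Cell → H1per,
          (∀ t ∈ Icc (-1 : ℝ) 1, ∀ f : L2Cell, ∀ᵐ x ∂(volume.restrict cell),
            fn (v t f) x = Complex.exp (-(x.1 : ℂ) * lam t) * fn (w (a t) f) x) ∧
          (∀ f : L2Cell, AnalyticOn ℝ (fun t => v t f) (Icc (-1) 1)) ∧
          (∀ m : ℕ, ∃ C : ℝ, ∀ f : L2Cell, ∀ t ∈ Icc (-1 : ℝ) 1,
            ‖iteratedDerivWithin m (fun s => v s f) (Icc (-1) 1) t‖ ≤ C * ‖f‖) := by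
  obtain ⟨Q, hQ⟩ := exists_potentialOp k hq_meas hq_pos hq_bdd
  have hu : UniqueDiffOn ℝ (Icc (-1 : ℝ) 1) := uniqueDiffOn_Icc (by norm_num)
  have hF : ∀ t ∈ Icc (-1 : ℝ) 1, a t ∉ floquetMultipliers k q := fun t ht h =>
    ha_avoid t ht (Or.inl h)
  have hne : ∀ t ∈ Icc (-1 : ℝ) 1, a t ≠ 0 := fun t ht h => ha_avoid t ht (Or.inr h)
  have hlog := exists_continuousOn_log ha.continuousOn hne
  -- The principal logarithm may jump along the curve. This is harmless: by uniqueness every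
  -- logarithm of `z` yields the same solution, which `hcurve` records for the branch at hand.
  set w : ℂ → L2Cell → H1Cell := fun z f =>
    gaugeCell (Complex.log z) (perSolution Q (Complex.log z) f).val with hw
  have huniq : ∀ z ∉ floquetMultipliers k q ∪ {0}, ∀ (f : L2Cell) (u : H1Cell),
      IsQPSolution k q z f u ↔ u = w z f := by
    intro z hz f u
    have hz0 : z ≠ 0 := fun h => hz (Or.inr h)
    have hzF : Complex.exp (Complex.log z) ∉ floquetMultipliers k q := by
      rw [Complex.exp_log hz0]
      exact fun h => hz (Or.inl h)
    have h := isQPSolution_iff hQ hzF f u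
    rwa [Complex.exp_log hz0] at h
  have hcurve : ∀ lam : ℝ → ℂ, (∀ t ∈ Icc (-1 : ℝ) 1, Complex.exp (lam t) = a t) →
      ∀ t ∈ Icc (-1 : ℝ) 1, ∀ f, w (a t) f = gaugeCell (lam t) (perSolution Q (lam t) f).val := by
    intro lam hlam t ht f
    have hexp : Complex.exp (lam t) ∉ floquetMultipliers k q := by
      rw [hlam t ht]
      exact hF t ht
    rw [← isQPSolution_iff hQ hexp f, hlam t ht, huniq _ (ha_avoid t ht)]
  have hunit : ∀ lam : ℝ → ℂ, (∀ t ∈ Icc (-1 : ℝ) 1, Complex.exp (lam t) = a t) →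
      ∀ t ∈ Icc (-1 : ℝ) 1, IsUnit (gaugedOperator perComponent Q (lam t)) :=
    fun lam hlam t ht => isUnit_gaugedOperator_of_notMem hQ (by rw [hlam t ht]; exact hF t ht)
  obtain ⟨lam₀, hlam₀, hexp₀⟩ := hlog
  have hT : AnalyticOn ℝ (fun t => cellSolution Q (lam₀ t)) (Icc (-1) 1) :=
    analyticOn_comp_curve (analyticOn_of_exp_eq ha hlam₀ hexp₀)
      fun t ht => analyticAt_cellSolution (hunit lam₀ hexp₀ t ht)
  have hTw : ∀ f, EqOn (β := SobolevCell) (fun t => w (a t) f)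
      (fun t => cellSolution Q (lam₀ t) f) (Icc (-1) 1) := fun f t ht =>
    (hcurve lam₀ hexp₀ t ht f).trans (cellSolution_apply Q (lam₀ t) f).symm
  refine ⟨w, huniq, fun f => ?_, fun m => ?_, ⟨lam₀, hlam₀, hexp₀⟩, fun lam hlam hexp => ?_⟩
  · exact (analyticOn_eval hT f).congr (hTw f)
  · obtain ⟨C, hC⟩ := exists_bound_iteratedDerivWithin isCompact_Icc hu (hT.contDiffOn hu) m
    refine ⟨C, fun f t ht => ?_⟩
    have h := iteratedDerivWithin_congr (F := SobolevCell) (n := m) (hTw f) ht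
    exact (congrArg norm h).trans_le (hC f t ht)
  · have hS : AnalyticOn ℝ (fun t => perSolution Q (lam t)) (Icc (-1) 1) :=
      analyticOn_comp_curve (analyticOn_of_exp_eq ha hlam hexp)
        fun t ht => analyticAt_perSolution (hunit lam hexp t ht)
    -- The periodic part depends on the branch, so it is built from the given `lam` and not from
    -- `lam₀`.
    refine ⟨fun t f => perSolution Q (lam t) f, fun t ht f => ?_, fun f => ?_, fun m => ?_⟩
    · filter_upwards [fn_gaugeCell (lam t) (perSolution Q (lam t) f).val] with x hx
      rw [hcurve lam hexp t ht f, hx, ← mul_assoc, ← Complex.exp_add]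
      have e : -(x.1 : ℂ) * lam t + lam t * x.1 = 0 := by ring
      rw [e, Complex.exp_zero, one_mul]
      rfl
    · exact analyticOn_eval hS f
    · obtain ⟨C, hC⟩ := exists_bound_iteratedDerivWithin isCompact_Icc hu (hS.contDiffOn hu) m
      exact ⟨C, hC⟩
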